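/- Let $\mathcal A=M_{n_1}\oplus\cdots\oplus M_{n_d}$ be a finite-dimensional $C^*$-algebra of complex block matrices, put $m=n_1+\cdots+n_d$, and let $\tau$ be a completely positive (CP) linear map on $\mathcal A$. Assume that $m\ge 2$ or $\tau\neq 0$. Let $r=r(\tau)$ be the spectral radius of $\tau$. Definitions. A linear map $\varphi$ on $\mathcal A$ is irreducible if there is no projection $p\in\mathcal A$, $p\ne 0,1$, with $\varphi(p\mathcal Ap)\subseteq p\mathcal Ap$. It is strictly positive if it maps every non-zero positive element to a strictly positive (i.e. positive invertible) element. If $r(\varphi)>0$, the maximal part of $\varphi$ is $$\widehat{\varphi}=\lim_{N\to\infty}\frac1N\sum_{n=1}^N\frac{\varphi^n}{\|\varphi^n\|_\beta},$$ where $\beta$ is any Jordan basis of $\varphi$ and $\|T\|_\beta$ is the largest modulus of an entry of the matrix of $T$ in the basis $\beta$. The maximal degeneracy index of $\varphi$ is the largest exponent of a factor $z-\lambda$ with $|\lambda|=r(\varphi)$ in the minimal polynomial of $\varphi$. The canonical extension of $\varphi$ to $M_m$ is $\widetilde\varphi=\iota\circ\varphi\circ\phi$, where $\iota:\mathcal A\to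 M_m$ is the block diagonal embedding and $\phi:M_m\to\mathcal A$ keeps the diagonal blocks. The Choi rank of a CP map $\sigma(X)=\sum_iA_i^*XA_i$ on $M_m$ is $\dim\operatorname{span}\{A_i\}$, which does not depend on the chosen decomposition. Theorem. The map $\tau$ is irreducible if and only if $r(\tau)>0$ and the maximal part $\widehat\tau$ is irreducible. In that case: 1. The maximal degeneracy index of $\tau$ is $1$. 2. $\widehat\tau$ is strictly positive and has rank $1$. 3. The canonical extension $\widetilde{\widehat\tau}$ of $\widehat\tau$ to $M_m$ has Choi rank $m^2$. In particular, there are $B_1,\dots,B_q\in M_m$ that span $M_m$ such that $\widehat\tau(X)=\sum_{j=1}^qB_j^*XB_j$ for all $X\in\mathcal A$ (with $\mathcal A\subseteq M_m$ via $\iota$). 4. There are a faithful state $\psi$ on $\mathcal A$ and a strictly positive $L\in\mathcal A$ such that $\widehat\tau(X)=\psi(X)L$ for all $X\in\mathcal A$, and (a) $\tau(L)=rL$, (b) $\psi(L)=1$, (c) $\psi\circ\tau=r\,\psi$. 5. $\tau$ has no positive generalized eigenvector for an eigenvalue of modulus less than $r$. Moreover, the only positive $X\in\mathcal A$ with $r^{-n}\tau^n(X)\to0$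 is $X=0$; in particular, if $r\ge1$, the only positive $X$ with $\tau^n(X)\to0$ is $X=0$. -/

import Mathlib

open Filter
open scoped Topology Matrix ComplexOrder MatrixOrder Matrix.Norms.L2Operator CStarAlgebra

/-! ### Linear maps on a finite-dimensional complex vector space -/

/-- A Jordan basis of `φ`: a basis that is a disjoint union of Jordan chains. The vectors
`x₀, x₁, …` of a chain with eigenvalue `c` satisfy `φ xⱼ = c xⱼ + xⱼ₊₁`, and `φ x = c x` for the
last vector `x` of the chain. -/
structure JordanBasis {V : Type*} [AddCommGroup V] [Module ℂ V] (φ : Module.End ℂ V) where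
  /-- the number of chains -/
  blocks : ℕ
  /-- the lengths of the chains -/
  size : Fin blocks → ℕ
  /-- the eigenvalues of the chains -/
  eig : Fin blocks → ℂ
  /-- the basis vectors -/
  basis : Module.Basis (Σ k, Fin (size k)) ℂ V
  apply_basis : ∀ k (j : Fin (size k)), φ (basis ⟨k, j⟩) =
    eig k • basis ⟨k, j⟩ + if h : (j : ℕ) + 1 < size k then basis ⟨k, ⟨j + 1, h⟩⟩ else 0

open Polynomial in
theorem exists_basis_quotient_X_sub_C_pow (c : ℂ) (e : ℕ) :
    ∃ b : Module.Basis (Fin e) ℂ (ℂ[X] ⧸ Ideal.span {(X - C c) ^ e}),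
      ∀ j, b j = Ideal.Quotient.mk _ ((X - C c) ^ (j : ℕ)) := by
  have hmon : ((X - C c) ^ e).Monic := (monic_X_sub_C c).pow e
  have hdeg : ((X - C c) ^ e).natDegree = e := by
    rw [(monic_X_sub_C c).natDegree_pow]; simp
  let pb : PowerBasis ℂ (ℂ[X] ⧸ Ideal.span {(X - C c) ^ e}) := AdjoinRoot.powerBasis' hmon
  have hfr : Module.finrank ℂ (ℂ[X] ⧸ Ideal.span {(X - C c) ^ e}) = e := by
    rw [pb.finrank]; exact hdeg
  have hli : LinearIndependent ℂ (fun j : Fin e =>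
      (Ideal.Quotient.mk (Ideal.span {(X - C c) ^ e}) ((X - C c) ^ (j : ℕ)))) := by
    rw [Fintype.linearIndependent_iff]
    intro g hg
    set P : ℂ[X] := ∑ j : Fin e, C (g j) * X ^ (j : ℕ) with hP
    have h1 : Ideal.Quotient.mk (Ideal.span {(X - C c) ^ e}) (P.comp (X - C c)) = 0 := by
      rw [← hg, hP, Polynomial.sum_comp, map_sum]
      refine Finset.sum_congr rfl fun j _ => ?_
      simp only [mul_comp, C_comp, pow_comp, X_comp]
      rw [← Polynomial.smul_eq_C_mul]
      rfl
    rw [Ideal.Quotient.eq_zero_iff_mem, Ideal.mem_span_singleton] at h1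
    have hPd : P.degree < e := by
      refine lt_of_le_of_lt (degree_sum_le _ _) ?_
      rw [Finset.sup_lt_iff (by exact WithBot.bot_lt_coe e)]
      intro j _
      exact lt_of_le_of_lt (degree_C_mul_X_pow_le _ _) (by exact_mod_cast j.2)
    have h0 : P.comp (X - C c) = 0 := by
      by_contra hne
      have h2 := natDegree_le_of_dvd h1 hne
      rw [hdeg, natDegree_comp, natDegree_X_sub_C, mul_one] at h2
      have hP0 : P ≠ 0 := by rintro h; simp [h] at hne
      have := (natDegree_lt_iff_degree_lt hP0).2 hPd
      omega
    have hP0 : P = 0 := by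
      have := congrArg (fun q => q.comp (X + C c)) h0
      simpa [comp_assoc] using this
    intro i
    have := congrArg (fun q => q.coeff (i : ℕ)) hP0
    simp only [hP, finsetSum_coeff, coeff_C_mul_X_pow, coeff_zero] at this
    rw [Finset.sum_eq_single i] at this
    · simpa using this
    · intro b _ hb
      rw [if_neg]
      intro h; exact hb (Fin.ext h.symm)
    · simp
  rcases Nat.eq_zero_or_pos e with rfl | he
  · have : Subsingleton (ℂ[X] ⧸ Ideal.span {(X - C c) ^ 0}) := by
      rw [Ideal.Quotient.subsingleton_iff]; simp
    exact ⟨Module.Basis.empty _, fun j => j.elim0⟩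
  · have : Nonempty (Fin e) := ⟨⟨0, he⟩⟩
    exact ⟨basisOfLinearIndependentOfCardEqFinrank hli (by simp [hfr]), fun j => by simp⟩

open Polynomial in
/-- Every endomorphism of a finite-dimensional complex vector space has a Jordan basis. -/
theorem nonempty_jordanBasis {V : Type*} [AddCommGroup V] [Module ℂ V] [FiniteDimensional ℂ V]
    (φ : Module.End ℂ V) : Nonempty (JordanBasis φ) := by
  classical
  have htor := Module.AEval.isTorsion_of_finiteDimensional ℂ V φ
  obtain ⟨ι, hι, p, hp, e, ⟨f⟩⟩ := Module.equiv_directSum_of_isTorsion htor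
  have hc : ∀ i, ∃ c : ℂ, Ideal.span {p i ^ e i} = Ideal.span {(X - C c) ^ e i} := by
    intro i
    have hd := IsAlgClosed.degree_eq_one_of_irreducible ℂ (hp i)
    obtain ⟨c, hc⟩ := Polynomial.exists_root_of_degree_eq_one hd
    refine ⟨c, ?_⟩
    rw [Ideal.span_singleton_eq_span_singleton]
    refine Associated.pow_pow ?_
    exact ((irreducible_X_sub_C c).associated_of_dvd (hp i) (dvd_iff_isRoot.2 hc)).symm
  choose c hc using hc
  have hb : ∀ i, ∃ b : Module.Basis (Fin (e i)) ℂ (ℂ[X] ⧸ Ideal.span {p i ^ e i}),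
      ∀ j, b j = Ideal.Quotient.mk _ ((X - C (c i)) ^ (j : ℕ)) := by
    intro i; rw [hc i]; exact exists_basis_quotient_X_sub_C_pow (c i) (e i)
  choose b hb using hb
  let B : Module.Basis (Σ i, Fin (e i)) ℂ (Π₀ i, ℂ[X] ⧸ Ideal.span {p i ^ e i}) :=
    DFinsupp.basis b
  have hB : ∀ i j, B ⟨i, j⟩ = DFinsupp.single i (b i j) := fun i j => by
    rw [← Module.Basis.repr_symm_single_one]
    change (DFinsupp.mapRange.linearEquiv fun i => (b i).repr).symm
      (sigmaFinsuppEquivDFinsupp (Finsupp.single ⟨i, j⟩ 1)) = _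
    rw [LinearEquiv.symm_apply_eq]
    simp
  let g : V ≃ₗ[ℂ] (Π₀ i, ℂ[X] ⧸ Ideal.span {p i ^ e i}) :=
    (Module.AEval.of ℂ V φ).trans (f.restrictScalars ℂ)
  have hg : ∀ y, φ (g.symm y) = g.symm ((X : ℂ[X]) • y) := by
    intro y
    apply g.injective
    rw [LinearEquiv.apply_symm_apply]
    have h1 : g (φ (g.symm y)) = (X : ℂ[X]) • g (g.symm y) := by
      change f (Module.AEval.of ℂ V φ (φ • (g.symm y))) = _
      rw [← Module.AEval.X_smul_of, map_smul]
      rfl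
    rw [h1, LinearEquiv.apply_symm_apply]
  let ε : Fin (Fintype.card ι) ≃ ι := (Fintype.equivFin ι).symm
  refine ⟨⟨Fintype.card ι, fun k => e (ε k), fun k => c (ε k),
    (B.map g.symm).reindex (Equiv.sigmaCongrLeft (β := fun i => Fin (e i)) ε).symm, ?_⟩⟩
  intro k j
  have hr : ∀ j, ((B.map g.symm).reindex
      (Equiv.sigmaCongrLeft (β := fun i => Fin (e i)) ε).symm) ⟨k, j⟩
        = g.symm (DFinsupp.single (ε k) (b (ε k) j)) := by
    intro j
    rw [Module.Basis.reindex_apply, Module.Basis.map_apply, Equiv.symm_symm, ← hB]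
    rfl
  rw [hr, hg, ← map_smul]
  have hsplit : (X : ℂ[X]) • DFinsupp.single (ε k) (b (ε k) j) =
      c (ε k) • DFinsupp.single (ε k) (b (ε k) j) +
        DFinsupp.single (β := fun i => ℂ[X] ⧸ Ideal.span {p i ^ e i}) (ε k)
          (Ideal.Quotient.mk (Ideal.span {p (ε k) ^ e (ε k)})
            ((X - C (c (ε k))) ^ ((j : ℕ) + 1))) := by
    rw [← DFinsupp.single_smul, ← DFinsupp.single_smul, ← DFinsupp.single_add, hb]
    congr 1
    change Ideal.Quotient.mk _ (X * _) =
      Ideal.Quotient.mk _ (c (ε k) • (X - C (c (ε k))) ^ (j : ℕ)) + _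
    rw [← map_add, Polynomial.smul_eq_C_mul]
    congr 1
    ring
  rw [hsplit, map_add]
  congr 1
  split_ifs with h
  · rw [hr, hb]
  · have hj : (j : ℕ) + 1 = e (ε k) := by
      have := j.2
      omega
    have h0 : Ideal.Quotient.mk (Ideal.span {p (ε k) ^ e (ε k)})
            ((X - C (c (ε k))) ^ ((j : ℕ) + 1)) = 0 := by
      rw [Ideal.Quotient.eq_zero_iff_mem, hj, hc]
      exact Ideal.mem_span_singleton_self _
    rw [h0, DFinsupp.single_zero, map_zero]

section LinearMaps

variable {V : Type*} [AddCommGroup V] [Module ℂ V]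

/-- The norm `‖T‖_β = ‖[T]_β‖_∞`: the largest modulus of an entry of the matrix of `T` in the
basis `β`. -/
noncomputable def JordanBasis.norm {φ : Module.End ℂ V} (β : JordanBasis φ)
    (T : Module.End ℂ V) : ℝ :=
  ⨆ p : (Σ k, Fin (β.size k)) × (Σ k, Fin (β.size k)),
    ‖LinearMap.toMatrix β.basis β.basis T p.1 p.2‖

/-- The spectral radius `r(φ)` as a real number. -/
noncomputable def specRadius (φ : Module.End ℂ V) : ℝ := (spectralRadius ℂ φ).toReal

/-- The degeneracy index of `φ` at `c`: the exponent of `z - c` in the minimal polynomial. -/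
noncomputable def degeneracyIndex (φ : Module.End ℂ V) (c : ℂ) : ℕ :=
  (minpoly ℂ φ).rootMultiplicity c

/-- The maximal degeneracy index of `φ`: the largest degeneracy index of an eigenvalue of
modulus `r(φ)`. -/
noncomputable def maxDegeneracyIndex (φ : Module.End ℂ V) : ℕ :=
  sSup {k | ∃ c : ℂ, φ.HasEigenvalue c ∧ ‖c‖ = specRadius φ ∧ degeneracyIndex φ c = k}

/-- `φhat` is the maximal part of `φ`: `r(φ) > 0` and, for every Jordan basis `β` of `φ`,
`φhat = lim_N (1/N) ∑_{n=1}^N φⁿ / ‖φⁿ‖_β`. In finite dimension the limit of linear maps is the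
pointwise limit. -/
def IsMaximalPart [TopologicalSpace V] (φ φhat : Module.End ℂ V) : Prop :=
  0 < specRadius φ ∧ ∀ (β : JordanBasis φ) (x : V),
    Tendsto (fun N : ℕ => (N : ℂ)⁻¹ •
      ∑ n ∈ Finset.Icc 1 N, ((β.norm (φ ^ n))⁻¹ : ℂ) • (φ ^ n) x) atTop (𝓝 (φhat x))

end LinearMaps

/-! ### Maps on C⋆-algebras -/

section CStar

variable {A : Type*} [CStarAlgebra A] [PartialOrder A]

/-- `φ` is irreducible: no projection `p` other than `0` and `1` has `φ(pAp) ⊆ pAp`. -/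
def IsIrreducibleMap (φ : Module.End ℂ A) : Prop :=
  ∀ p : A, IsStarProjection p → (∀ X : A, ∃ Y : A, φ (p * X * p) = p * Y * p) → p = 0 ∨ p = 1

/-- `φ` maps non-zero positive elements to strictly positive (positive invertible) elements. -/
def IsStrictlyPositiveMap (φ : Module.End ℂ A) : Prop :=
  ∀ X : A, 0 ≤ X → X ≠ 0 → IsStrictlyPositive (φ X)

/-- `ψ` is a faithful state. -/
structure IsFaithfulState (ψ : A →ₗ[ℂ] ℂ) : Prop where
  nonneg : ∀ X : A, 0 ≤ X → 0 ≤ ψ X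
  map_one : ψ 1 = 1
  faithful : ∀ X : A, 0 ≤ X → ψ X = 0 → X = 0

end CStar

/-! ### Block algebras -/

section Blocks

/-- The C⋆-algebra `M_{n₁} ⊕ ⋯ ⊕ M_{n_d}`. -/
abbrev BlockAlgebra {d : ℕ} (n : Fin d → ℕ) : Type := ∀ i, Matrix (Fin (n i)) (Fin (n i)) ℂ

/-- The full matrix algebra `M_m`, `m = n₁ + ⋯ + n_d`; rows and columns are indexed by the
disjoint union of the index sets of the blocks. -/
abbrev FullMatrix {d : ℕ} (n : Fin d → ℕ) : Type :=
  Matrix (Σ i, Fin (n i)) (Σ i, Fin (n i)) ℂ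

/-- The canonical extension `ι ∘ τ ∘ ϕ` of `τ` to `M_m`, where `ι` is the block diagonal embedding
and `ϕ` takes a matrix to its diagonal blocks. -/
def canonicalExtension {d : ℕ} {n : Fin d → ℕ} (τ : Module.End ℂ (BlockAlgebra n)) :
    Module.End ℂ (FullMatrix n) where
  toFun X := Matrix.blockDiagonal' (τ (Matrix.blockDiag' X))
  map_add' X Y := by
    rw [Matrix.blockDiag'_add, map_add, Matrix.blockDiagonal'_add]
  map_smul' c X := by
    rw [Matrix.blockDiag'_smul, map_smul, Matrix.blockDiagonal'_smul, RingHom.id_apply]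

/-- `A₁, …, A_p` are Choi-Kraus coefficients of `τ`: `τ(X) = ∑ Aᵢ* X Aᵢ`. -/
def IsChoiKraus {I : Type*} [Fintype I] (τ : Module.End ℂ (Matrix I I ℂ)) {p : ℕ}
    (A : Fin p → Matrix I I ℂ) : Prop :=
  ∀ X, τ X = ∑ i, (A i)ᴴ * X * A i

/-- The coefficient space of `τ`: the span of the Choi-Kraus coefficients of `τ`. All Choi-Kraus
decompositions of `τ` have the same span, and the supremum below is over all of them. -/
def coefficientSpace {I : Type*} [Fintype I] (τ : Module.End ℂ (Matrix I I ℂ)) :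
    Submodule ℂ (Matrix I I ℂ) :=
  ⨆ (p : ℕ) (A : Fin p → Matrix I I ℂ) (_ : IsChoiKraus τ A), Submodule.span ℂ (Set.range A)

/-- The Choi rank of `τ`. -/
noncomputable def choiRank {I : Type*} [Fintype I] (τ : Module.End ℂ (Matrix I I ℂ)) : ℕ :=
  Module.finrank ℂ (coefficientSpace τ)

end Blocks

/-!
A completely positive map enters the argument only as a positive linear map `τ` on a
finite-dimensional `C⋆`-algebra `A`; the theorem is then the Perron–Frobenius theorem for `τ`.

*Strict positivity.* If `Y ≥ 0` is non-zero and `τ Y ≤ C Y`, then the support projection of `Y`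
spans an invariant corner, so for irreducible `τ` the element `Y` is strictly positive
(`IsIrreducibleMap.isStrictlyPositive_of_apply_le`). By Cayley–Hamilton this applies to
the sum `Y` of the `τ ^ k X` with `k < dim A`, for every non-zero `X ≥ 0`
(`IsIrreducibleMap.isStrictlyPositive_orbitSum`).

*The eigenvector.* A Collatz–Wielandt maximum over the compact base of the positive cone gives
`r > 0` and a strictly positive `L` with `τ L = r L`
(`IsIrreducibleMap.exists_strictlyPositive_eigenvector`). As `L` is an order unit,
`‖τ ^ n X‖ = O(r ^ n)` for every `X`, and the eigenspace of `r` is `ℂ L`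
(`IsIrreducibleMap.exists_eq_smul`).

*The functional.* Since orbits are `O(r ^ n)`, there are no Jordan chains of length two for
eigenvalues of modulus `r` (`eq_zero_of_jordanChain`). Hence `A` is the direct sum of `ℂ L` and the
range of `τ - r`, on which the Cesàro means of `r ^ (-n) τ ^ n` telescope to `0`; so these means
converge to `X ↦ ψ X • L` for a functional `ψ` with `ψ ∘ τ = r ψ`
(`exists_functional_tendsto_cesaro`). The limit of positive maps is positive, and `ψ` is faithful
because it is an eigenfunctional and `orbitSum τ` is strictly positive.

*The maximal part.* In a Jordan basis the chains of eigenvalues of modulus `r` have length one and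
all other chains contribute `o(r ^ n)`, so `‖τ ^ n‖_β = r ^ n` for large `n`
(`JordanBasis.eventually_norm_pow_eq`), and the maximal part is `X ↦ ψ X • L`. The Choi rank is read
off from explicit Kraus coefficients `D Eᵢⱼ C`, where `C* C = L` and `D D*` is the density matrix
of `ψ` (`exists_isChoiKraus_span_eq_top`), and the assertions on positive generalized eigenvectors
and decaying orbits follow by applying `ψ`. Conversely a corner invariant under `τ` is
invariant under the limit, so irreducibility of the maximal part implies that of `τ`
(`IsMaximalPart.isIrreducibleMap`).
-/

/-! ### Iterates of a linear map -/

section Iterates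

variable {A : Type*} [AddCommGroup A] [Module ℂ A] {τ : Module.End ℂ A}

/-- The polynomial `1 + τ + ⋯ + τ ^ (D - 1)`, `D = dim A`, in `τ`. -/
noncomputable def orbitSum (τ : Module.End ℂ A) : Module.End ℂ A :=
  ∑ k ∈ Finset.range (Module.finrank ℂ A), τ ^ k

theorem orbitSum_apply (X : A) :
    orbitSum τ X = ∑ k ∈ Finset.range (Module.finrank ℂ A), (τ ^ k) X := by
  simp [orbitSum, LinearMap.sum_apply]

theorem orbitSum_comm (X : A) : orbitSum τ (τ X) = τ (orbitSum τ X) := by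
  rw [orbitSum_apply, orbitSum_apply, map_sum]
  refine Finset.sum_congr rfl fun k _ => ?_
  rw [← Module.End.mul_apply, ← Module.End.mul_apply, ← pow_succ, ← pow_succ']

theorem LinearMap.pow_apply_of_apply_eq_smul {X : A} {r : ℝ} (h : τ X = r • X) (k : ℕ) :
    (τ ^ k) X = r ^ k • X := by
  induction k with
  | zero => simp
  | succ k ih =>
    rw [pow_succ', Module.End.mul_apply, ih, LinearMap.map_smul_of_tower, h, smul_smul, pow_succ]

theorem LinearMap.pow_nonneg_of_nonneg [PartialOrder A] (hpos : ∀ X, 0 ≤ X → 0 ≤ τ X) (k : ℕ)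
    {X : A} (hX : 0 ≤ X) : 0 ≤ (τ ^ k) X := by
  induction k with
  | zero => simpa
  | succ k ih => rw [pow_succ', Module.End.mul_apply]; exact hpos _ ih

theorem LinearMap.apply_pow_of_apply_eq {V : Type*} [AddCommGroup V] [Module ℂ V]
    {φ : Module.End ℂ V} {ψ : V →ₗ[ℂ] ℂ} {r : ℂ} (h : ∀ x, ψ (φ x) = r * ψ x) (k : ℕ) (x : V) :
    ψ ((φ ^ k) x) = r ^ k * ψ x := by
  induction k with
  | zero => simp
  | succ k ih => rw [pow_succ', Module.End.mul_apply, h, ih, pow_succ]; ring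

/-- An eigenfunctional vanishes on the generalized eigenspaces of all other eigenvalues. -/
theorem LinearMap.apply_eq_zero_of_mem_maxGenEigenspace {V : Type*} [AddCommGroup V] [Module ℂ V]
    {φ : Module.End ℂ V} {ψ : V →ₗ[ℂ] ℂ} {r : ℂ} (h : ∀ x, ψ (φ x) = r * ψ x) {c : ℂ}
    (hc : c ≠ r) {x : V} (hx : x ∈ Module.End.maxGenEigenspace φ c) : ψ x = 0 := by
  obtain ⟨k, hk⟩ := (Module.End.mem_maxGenEigenspace φ c x).1 hx
  have h1 := LinearMap.apply_pow_of_apply_eq (φ := φ - c • (1 : Module.End ℂ V)) (ψ := ψ)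
    (r := r - c) (fun x => by simp [h, sub_mul]) k x
  rw [hk, map_zero] at h1
  exact (mul_eq_zero.1 h1.symm).resolve_left (pow_ne_zero _ (sub_ne_zero.2 hc.symm))

end Iterates

/-! ### Order units and support projections -/

theorem spectrum.finite_real {A : Type*} [CStarAlgebra A] [FiniteDimensional ℂ A]
    (Y : A) : (spectrum ℝ Y).Finite := by
  have : FiniteDimensional ℝ A := FiniteDimensional.complexToReal A
  obtain ⟨q, hq, hq0⟩ := Algebra.IsIntegral.isIntegral (R := ℝ) Y
  rcases subsingleton_or_nontrivial A with _ | _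
  · rw [spectrum.of_subsingleton]; exact Set.finite_empty
  refine (q.rootSet_finite ℝ).subset fun x hx => ?_
  have h := spectrum.subset_polynomial_aeval Y q ⟨x, hx, rfl⟩
  rw [Polynomial.aeval_def, hq0, spectrum.zero_eq] at h
  rw [Polynomial.mem_rootSet]
  exact ⟨hq.ne_zero, by simpa using h⟩

section Support

variable {A : Type*} [CStarAlgebra A] [PartialOrder A] [StarOrderedRing A]

theorem IsStrictlyPositive.exists_pos_algebraMap_le [Nontrivial A] {L : A}
    (hL : IsStrictlyPositive L) : ∃ ε : ℝ, 0 < ε ∧ algebraMap ℝ A ε ≤ L :=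
  (CFC.exists_pos_algebraMap_le_iff hL.nonneg.isSelfAdjoint).2
    fun x hx => (StarOrderedRing.isStrictlyPositive_iff_spectrum_pos (R := ℝ) L
      hL.nonneg.isSelfAdjoint).1 hL x hx

/-- A strictly positive element is an order unit. -/
theorem IsSelfAdjoint.exists_le_smul_of_isStrictlyPositive {X L : A} (hX : IsSelfAdjoint X)
    (hL : IsStrictlyPositive L) : ∃ C : ℝ, 0 < C ∧ X ≤ C • L := by
  rcases subsingleton_or_nontrivial A with _ | _
  · exact ⟨1, one_pos, (Subsingleton.elim _ _).le⟩
  obtain ⟨ε, hε, hεL⟩ := hL.exists_pos_algebraMap_le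
  refine ⟨(‖X‖ + 1) / ε, by positivity, ?_⟩
  have h1 : X ≤ algebraMap ℝ A ‖X‖ := hX.le_algebraMap_norm_self
  have h2 : algebraMap ℝ A ‖X‖ ≤ algebraMap ℝ A (‖X‖ + 1) :=
    algebraMap_mono A (by linarith)
  have h3 : ((‖X‖ + 1) / ε) • algebraMap ℝ A ε ≤ ((‖X‖ + 1) / ε) • L :=
    smul_le_smul_of_nonneg_left hεL (by positivity)
  rw [Algebra.smul_def, ← map_mul, div_mul_cancel₀ _ hε.ne'] at h3
  exact h1.trans (h2.trans h3)

/-- In finite dimension a positive element has a support projection: the spectrum is finite, so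
the indicator function of `x ≠ 0` is continuous on it. -/
theorem exists_isStarProjection_support [FiniteDimensional ℂ A] {Y : A} (hY : 0 ≤ Y) :
    ∃ p : A, IsStarProjection p ∧ p * Y = Y ∧ Y * p = Y ∧ ∃ C : ℝ, 0 < C ∧ p ≤ C • Y := by
  have hfin := spectrum.finite_real Y
  have hsa : IsSelfAdjoint Y := hY.isSelfAdjoint
  have hc : ∀ f : ℝ → ℝ, ContinuousOn f (spectrum ℝ Y) := fun f => hfin.continuousOn f
  let f : ℝ → ℝ := fun x => if x = 0 then 0 else 1
  have hcomm : cfc f Y * Y = Y := by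
    have h : cfc (fun x => f x * x) Y = cfc f Y * cfc (fun x => x) Y :=
      cfc_mul f (fun x => x) Y (hc _) (hc _)
    have hfx : (fun x => f x * x) = fun x => x := by
      ext x
      by_cases hx : x = 0 <;> simp [f, hx]
    rw [hfx, cfc_id' ℝ Y] at h
    exact h.symm
  have hproj : IsStarProjection (cfc f Y) := by
    refine ⟨?_, cfc_predicate f Y⟩
    rw [IsIdempotentElem, ← cfc_mul f f Y (hc _) (hc _)]
    congr 1
    ext x
    by_cases hx : x = 0 <;> simp [f, hx]
  refine ⟨cfc f Y, hproj, hcomm, ?_, ?_⟩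
  · have := congrArg star hcomm
    rwa [star_mul, hsa.star_eq, hproj.isSelfAdjoint.star_eq] at this
  · obtain ⟨C, hC⟩ := (hfin.image fun x => x⁻¹).bddAbove
    refine ⟨max C 1, by positivity, ?_⟩
    have : (max C 1) • Y = cfc (fun x => max C 1 * x) Y := by
      rw [cfc_const_mul_id (max C 1) Y]
    rw [this]
    refine cfc_mono (fun x hx => ?_) (hc _) (hc _)
    have hx0 : 0 ≤ x := spectrum_nonneg_of_nonneg hY hx
    by_cases h0 : x = 0
    · simp [f, h0]
    · simp only [f, h0, if_false]
      have hxp : 0 < x := lt_of_le_of_ne hx0 (Ne.symm h0)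
      have := hC ⟨x, hx, rfl⟩
      calc (1 : ℝ) = x⁻¹ * x := by field_simp
        _ ≤ _ := by gcongr; exact this.trans (le_max_left _ _)

theorem IsStarProjection.conjugate_le_norm_smul {p X : A} (hp : IsStarProjection p)
    (hX : IsSelfAdjoint X) : p * X * p ≤ ‖X‖ • p := by
  have := CStarAlgebra.star_left_conjugate_le_norm_smul (a := p) hX
  rwa [hp.isSelfAdjoint.star_eq, hp.isIdempotentElem] at this

theorem IsStarProjection.conjugate_of_nonneg_of_le_smul {p X : A} (hp : IsStarProjection p)
    (hX : 0 ≤ X) {C : ℝ} (hC : 0 ≤ C) (hXp : X ≤ C • p) : p * X * p = X := by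
  have hC1 : 0 < C + 1 := by linarith
  have h1 : (C + 1)⁻¹ • X ≤ p := by
    rw [inv_smul_le_iff_of_pos hC1]
    exact hXp.trans (smul_le_smul_of_nonneg_right (by linarith) hp.nonneg)
  have h2 := hp.conjugate_of_nonneg_of_le (smul_nonneg (by positivity) hX) h1
  rw [mul_smul_comm, smul_mul_assoc] at h2
  exact smul_right_injective A (inv_ne_zero hC1.ne') h2

end Support

/-! ### Irreducible positive maps -/

section Positive

variable {A : Type*} [CStarAlgebra A] [PartialOrder A] [StarOrderedRing A]
  {τ : Module.End ℂ A}

theorem LinearMap.map_le_map_of_nonneg (hpos : ∀ X, 0 ≤ X → 0 ≤ τ X) {X Y : A} (h : X ≤ Y) :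
    τ X ≤ τ Y := by
  have := hpos _ (sub_nonneg.2 h)
  rwa [map_sub, sub_nonneg] at this

/-- The support projection `p` of `Y` satisfies `τ (p A p) ⊆ p A p` as soon as `τ Y` is dominated
by a multiple of `Y`; so `p = 1` by irreducibility. -/
theorem IsIrreducibleMap.isStrictlyPositive_of_apply_le [FiniteDimensional ℂ A]
    (hirr : IsIrreducibleMap τ) (hpos : ∀ X, 0 ≤ X → 0 ≤ τ X) {Y : A} (hY : 0 ≤ Y) (hY0 : Y ≠ 0)
    {C : ℝ} (hC : 0 ≤ C) (h : τ Y ≤ C • Y) : IsStrictlyPositive Y := by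
  obtain ⟨p, hp, hpY, hYp, C', hC', hpC'⟩ := exists_isStarProjection_support hY
  have hYle : Y ≤ ‖Y‖ • p := by
    have := hp.conjugate_le_norm_smul hY.isSelfAdjoint
    rwa [hpY, hYp] at this
  have hinv : ∀ X : A, p * τ (p * X * p) * p = τ (p * X * p) := by
    intro X
    have hX : X ∈ Submodule.span ℂ {a : A | 0 ≤ a} := by
      rw [CStarAlgebra.span_nonneg]; trivial
    induction hX using Submodule.span_induction with
    | mem X hX =>
      have hX' : 0 ≤ X := hX
      have h0 : 0 ≤ p * X * p := hp.isSelfAdjoint.conjugate_nonneg hX'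
      refine hp.conjugate_of_nonneg_of_le_smul (C := ‖X‖ * (C' * (C * ‖Y‖))) (hpos _ h0)
        (by positivity) ?_
      have h1 : τ (p * X * p) ≤ τ (‖X‖ • p) :=
        LinearMap.map_le_map_of_nonneg hpos (hp.conjugate_le_norm_smul hX'.isSelfAdjoint)
      have h2 : τ p ≤ τ (C' • Y) := LinearMap.map_le_map_of_nonneg hpos hpC'
      rw [LinearMap.map_smul_of_tower] at h1 h2
      have h3 : C • Y ≤ (C * ‖Y‖) • p := by
        rw [mul_smul]; exact smul_le_smul_of_nonneg_left hYle hC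
      have h4 : τ p ≤ (C' * (C * ‖Y‖)) • p := by
        rw [mul_smul]
        exact h2.trans (smul_le_smul_of_nonneg_left (h.trans h3) hC'.le)
      rw [mul_smul]
      exact h1.trans (smul_le_smul_of_nonneg_left h4 (norm_nonneg _))
    | zero => simp
    | add X Z _ _ hX hZ => simp only [mul_add, add_mul, map_add, hX, hZ]
    | smul c X _ hX => simp only [mul_smul_comm, smul_mul_assoc, map_smul, hX]
  rcases hirr p hp fun X => ⟨τ (p * X * p), (hinv X).symm⟩ with rfl | rfl
  · exact absurd (by simpa using hpY.symm) hY0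
  · have h1 : IsStrictlyPositive (1 : A) := ⟨zero_le_one, isUnit_one⟩
    have h2 : C'⁻¹ • (1 : A) ≤ Y := by rwa [inv_smul_le_iff_of_pos hC']
    refine IsStrictlyPositive.of_le ?_ h2
    refine ⟨smul_nonneg (by positivity) zero_le_one, ?_⟩
    rw [← Algebra.algebraMap_eq_smul_one]
    exact (isUnit_iff_ne_zero.2 (inv_ne_zero hC'.ne')).map (algebraMap ℝ A)

theorem orbitSum_nonneg (hpos : ∀ X, 0 ≤ X → 0 ≤ τ X) {X : A} (hX : 0 ≤ X) :
    0 ≤ orbitSum τ X := by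
  rw [orbitSum_apply]
  exact Finset.sum_nonneg fun k _ => LinearMap.pow_nonneg_of_nonneg hpos k hX

/-- For irreducible `τ`, the map `orbitSum τ` is strictly positive. By the Cayley–Hamilton theorem,
`Y = orbitSum τ X` dominates all powers `τ ^ k X` up to a constant, hence also `τ Y`. -/
theorem IsIrreducibleMap.isStrictlyPositive_orbitSum [FiniteDimensional ℂ A]
    (hirr : IsIrreducibleMap τ) (hpos : ∀ X, 0 ≤ X → 0 ≤ τ X) :
    IsStrictlyPositiveMap (orbitSum τ) := by
  intro X hX hX0
  have : Nontrivial A := ⟨X, 0, hX0⟩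
  set D := Module.finrank ℂ A with hD
  have hDpos : 0 < D := Module.finrank_pos
  set Y := orbitSum τ X with hYdef
  have hY : 0 ≤ Y := orbitSum_nonneg hpos hX
  have hle : ∀ k < D, (τ ^ k) X ≤ Y := by
    intro k hk
    rw [hYdef, orbitSum_apply]
    exact Finset.single_le_sum (f := fun k => (τ ^ k) X)
      (fun i _ => LinearMap.pow_nonneg_of_nonneg hpos i hX) (Finset.mem_range.2 hk)
  have hY0 : Y ≠ 0 := by
    intro h0
    have := hle 0 hDpos
    rw [h0] at this
    exact hX0 (le_antisymm (by simpa using this) hX)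
  obtain ⟨p, hp, hpY, hYp, C, hC, hpC⟩ := exists_isStarProjection_support hY
  have hYle : Y ≤ ‖Y‖ • p := by
    have := hp.conjugate_le_norm_smul hY.isSelfAdjoint
    rwa [hpY, hYp] at this
  have hcorner : ∀ k < D, p * (τ ^ k) X * p = (τ ^ k) X := fun k hk =>
    hp.conjugate_of_nonneg_of_le_smul (LinearMap.pow_nonneg_of_nonneg hpos k hX)
      (norm_nonneg _) ((hle k hk).trans hYle)
  have hCH : (τ ^ D) X =
      -∑ k ∈ Finset.range D, (LinearMap.charpoly τ).coeff k • (τ ^ k) X := by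
    have h := LinearMap.aeval_self_charpoly τ
    rw [(LinearMap.charpoly_monic τ).as_sum, LinearMap.charpoly_natDegree] at h
    have h' := congrArg (fun f : Module.End ℂ A => f X) h
    simp only [map_add, map_pow, Polynomial.aeval_X, map_sum, map_mul, Polynomial.aeval_C,
      LinearMap.add_apply, LinearMap.sum_apply, Module.End.mul_apply,
      Module.algebraMap_end_apply, LinearMap.zero_apply] at h'
    exact eq_neg_of_add_eq_zero_left h'
  have hcornerD : p * (τ ^ D) X * p = (τ ^ D) X := by
    rw [hCH, mul_neg, neg_mul, Finset.mul_sum, Finset.sum_mul]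
    congr 1
    refine Finset.sum_congr rfl fun k hk => ?_
    rw [mul_smul_comm, smul_mul_assoc, hcorner k (Finset.mem_range.1 hk)]
  have hDle : (τ ^ D) X ≤ (‖(τ ^ D) X‖ * C) • Y := by
    have h1 := hp.conjugate_le_norm_smul
      (LinearMap.pow_nonneg_of_nonneg hpos D hX).isSelfAdjoint
    rw [hcornerD] at h1
    rw [mul_smul]
    exact h1.trans (smul_le_smul_of_nonneg_left hpC (norm_nonneg _))
  refine hirr.isStrictlyPositive_of_apply_le hpos hY hY0
    (C := 1 + ‖(τ ^ D) X‖ * C) (by positivity) ?_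
  have hτY : τ Y + X = Y + (τ ^ D) X := by
    rw [hYdef, orbitSum_apply, map_sum, ← hD, ← Finset.sum_range_succ, Finset.sum_range_succ']
    simp [pow_succ', Module.End.mul_apply]
  calc τ Y ≤ τ Y + X := le_add_of_nonneg_right hX
    _ = Y + (τ ^ D) X := hτY
    _ ≤ Y + (‖(τ ^ D) X‖ * C) • Y := by gcongr
    _ = _ := by rw [add_smul, one_smul]

end Positive

/-! ### Linear maps with orbits of order `r ^ n` -/

section BoundedOrbits

variable {V : Type*} [NormedAddCommGroup V] [NormedSpace ℂ V] {φ : Module.End ℂ V} {r : ℝ}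

/-- If `‖φ ^ n x‖ = O(r ^ n)` for all `x`, then `φ` has no Jordan chain of length two for an
eigenvalue of modulus `r`: on such a chain `φ ^ n` grows like `n * r ^ n`. -/
theorem eq_zero_of_jordanChain (hr : 0 < r) (hb : ∀ x, ∃ C, ∀ n, ‖(φ ^ n) x‖ ≤ C * r ^ n)
    {c : ℂ} (hc : ‖c‖ = r) {v w : V} (hv : φ v = c • v + w) (hw : φ w = c • w) : w = 0 := by
  have hc0 : c ≠ 0 := by rintro rfl; simp at hc; exact hr.ne hc
  obtain ⟨u, rfl⟩ : ∃ u, w = c • u := ⟨c⁻¹ • w, by rw [smul_inv_smul₀ hc0]⟩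
  have hu : φ u = c • u := by
    rw [map_smul] at hw
    exact smul_right_injective V hc0 hw
  have hpow : ∀ n : ℕ, (φ ^ n) v = c ^ n • (v + (n : ℂ) • u) := by
    intro n
    induction n with
    | zero => simp
    | succ n ih =>
      rw [pow_succ', Module.End.mul_apply, ih, map_smul, map_add, map_smul, hv, hu, pow_succ]
      push_cast
      module
  obtain ⟨C, hC⟩ := hb v
  have hbound : ∀ n : ℕ, n * ‖u‖ ≤ C + ‖v‖ := by
    intro n
    have h1 := hC n
    rw [hpow, norm_smul, norm_pow, hc, mul_comm] at h1
    have h2 : ‖v + (n : ℂ) • u‖ ≤ C := le_of_mul_le_mul_right h1 (by positivity)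
    have h3 : ‖(n : ℂ) • u‖ ≤ ‖v + (n : ℂ) • u‖ + ‖v‖ := by
      calc ‖(n : ℂ) • u‖ = ‖(v + (n : ℂ) • u) - v‖ := by rw [add_sub_cancel_left]
        _ ≤ _ := norm_sub_le _ _
    rw [norm_smul, Complex.norm_natCast] at h3
    linarith
  by_contra hne
  have hu0 : 0 < ‖u‖ := norm_pos_iff.2 fun h => hne (by rw [h, smul_zero])
  obtain ⟨n, hn⟩ := exists_nat_gt ((C + ‖v‖) / ‖u‖)
  rw [div_lt_iff₀ hu0] at hn
  exact absurd (hbound n) (not_le.2 hn)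

theorem pow_apply_of_apply_eq {c : ℂ} {x : V} (h : φ x = c • x) (n : ℕ) :
    (φ ^ n) x = c ^ n • x := by
  induction n with
  | zero => simp
  | succ n ih => rw [pow_succ', Module.End.mul_apply, ih, map_smul, h, smul_smul, pow_succ]

/-- An ergodic theorem: if `r` is an eigenvalue of `φ` with one-dimensional eigenspace `ℂ L` and
`‖φ ^ n x‖ = O(r ^ n)`, then the Cesàro means of `r ^ (-n) φ ^ n` converge to a projection
`x ↦ ψ x • L`. Indeed `V` is the direct sum of `ℂ L` and the range of `φ - r`, on which the sums
telescope. -/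
theorem exists_functional_tendsto_cesaro [FiniteDimensional ℂ V] (hr : 0 < r)
    (hb : ∀ x, ∃ C, ∀ n, ‖(φ ^ n) x‖ ≤ C * r ^ n) {L : V} (hL0 : L ≠ 0)
    (hL : φ L = (r : ℂ) • L) (huniq : ∀ x, φ x = (r : ℂ) • x → ∃ c : ℂ, x = c • L) :
    ∃ ψ : V →ₗ[ℂ] ℂ, ψ L = 1 ∧ (∀ x, ψ (φ x) = r * ψ x) ∧
      ∀ x, Tendsto (fun N : ℕ => (N : ℂ)⁻¹ • ∑ n ∈ Finset.Icc 1 N,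
        ((r : ℂ) ^ n)⁻¹ • (φ ^ n) x) atTop (𝓝 (ψ x • L)) := by
  have hrc : (r : ℂ) ≠ 0 := by exact_mod_cast hr.ne'
  set f : Module.End ℂ V := φ - (r : ℂ) • (1 : Module.End ℂ V) with hf
  have hfx : ∀ x, f x = φ x - (r : ℂ) • x := fun x => by simp [hf]
  have hLf : L ∉ LinearMap.range f := by
    rintro ⟨y, hy⟩
    refine hL0 (eq_zero_of_jordanChain hr hb (c := r) (v := y) ?_ ?_ hL)
    · simp [abs_of_pos hr]
    · rw [← hy, hfx]; abel
  obtain ⟨ψ₀, hψL, hψr⟩ := Submodule.exists_le_ker_of_notMem hLf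
  set ψ : V →ₗ[ℂ] ℂ := (ψ₀ L)⁻¹ • ψ₀ with hψ
  have hψL1 : ψ L = 1 := by simp [hψ, hψL]
  have hψf : ∀ x, ψ (f x) = 0 := fun x => by
    have : ψ₀ (f x) = 0 := hψr ⟨x, rfl⟩
    simp [hψ, this]
  have hker : LinearMap.ker f ≤ Submodule.span ℂ {L} := by
    intro x hx
    obtain ⟨c, rfl⟩ := huniq x (sub_eq_zero.1 (by rw [← hfx]; exact hx))
    exact Submodule.smul_mem _ _ (Submodule.mem_span_singleton_self L)
  have hrange : LinearMap.range f = LinearMap.ker ψ := by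
    refine Submodule.eq_of_le_of_finrank_le ?_ ?_
    · rintro _ ⟨x, rfl⟩; exact hψf x
    · have h1 := LinearMap.finrank_range_add_finrank_ker f
      have h2 := LinearMap.finrank_range_add_finrank_ker ψ
      have h3 : Module.finrank ℂ (LinearMap.ker f) ≤ 1 :=
        (Submodule.finrank_mono hker).trans (finrank_span_singleton hL0).le
      have h4 : LinearMap.range ψ ≠ ⊥ := by
        rw [Ne, LinearMap.range_eq_bot]
        intro h; rw [h] at hψL1; simp at hψL1
      have h5 : Module.finrank ℂ (LinearMap.range ψ) ≠ 0 := by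
        rwa [Ne, Submodule.finrank_eq_zero]
      omega
  refine ⟨ψ, hψL1, fun x => ?_, fun x => ?_⟩
  · have := hψf x
    rw [hfx, map_sub, map_smul, smul_eq_mul, sub_eq_zero] at this
    exact this
  · obtain ⟨y, hy⟩ : x - ψ x • L ∈ LinearMap.range f := by
      rw [hrange, LinearMap.mem_ker, map_sub, map_smul, hψL1]; simp
    have hx : x = ψ x • L + f y := by rw [hy]; abel
    set u : ℕ → V := fun n => ((r : ℂ) ^ n)⁻¹ • (φ ^ n) y with hu
    have hterm : ∀ n, ((r : ℂ) ^ n)⁻¹ • (φ ^ n) x =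
        ψ x • L + (r : ℂ) • (u (n + 1) - u n) := by
      intro n
      conv_lhs => rw [hx]
      rw [map_add, map_smul, pow_apply_of_apply_eq hL, hfx, map_sub, map_smul,
        ← Module.End.mul_apply, ← pow_succ, smul_add, smul_comm _ (ψ x), smul_smul _ ((r : ℂ) ^ n),
        inv_mul_cancel₀ (pow_ne_zero _ hrc), one_smul, hu]
      simp only [smul_sub, smul_smul]
      congr 3
      · rw [pow_succ]; field_simp
      · ring
    have hsum : ∀ N : ℕ, N ≠ 0 → (N : ℂ)⁻¹ • ∑ n ∈ Finset.Icc 1 N, ((r : ℂ) ^ n)⁻¹ • (φ ^ n) x =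
        ψ x • L + (N : ℂ)⁻¹ • ((r : ℂ) • (u (N + 1) - u 1)) := by
      intro N hN
      have htel : ∑ n ∈ Finset.Icc 1 N, (r : ℂ) • (u (n + 1) - u n) =
          (r : ℂ) • (u (N + 1) - u 1) := by
        rw [← Finset.smul_sum, ← Finset.Ico_add_one_right_eq_Icc, Finset.sum_Ico_sub u (by omega)]
      rw [Finset.sum_congr rfl fun n _ => hterm n, Finset.sum_add_distrib, htel,
        Finset.sum_const, Nat.card_Icc, Nat.add_sub_cancel, smul_add, ← Nat.cast_smul_eq_nsmul ℂ,
        smul_smul, inv_mul_cancel₀ (Nat.cast_ne_zero.2 hN), one_smul]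
    obtain ⟨C, hC⟩ := hb y
    have hubd : ∀ n, ‖u n‖ ≤ C := by
      intro n
      rw [hu]
      simp only [norm_smul, norm_inv, norm_pow, Complex.norm_real, Real.norm_of_nonneg hr.le]
      rw [inv_mul_le_iff₀ (by positivity), mul_comm]
      exact hC n
    have hlim : Tendsto (fun N : ℕ => (N : ℂ)⁻¹ • ((r : ℂ) • (u (N + 1) - u 1))) atTop (𝓝 0) := by
      refine squeeze_zero_norm (a := fun N : ℕ => (N : ℝ)⁻¹ * (r * (C + C))) (fun N => ?_) ?_
      · rw [norm_smul, norm_smul, norm_inv, Complex.norm_natCast, Complex.norm_real,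
          Real.norm_of_nonneg hr.le]
        gcongr
        exact (norm_sub_le _ _).trans (add_le_add (hubd _) (hubd _))
      · simpa using (tendsto_inv_atTop_nhds_zero_nat (𝕜 := ℝ)).mul_const (r * (C + C))
    have := (tendsto_const_nhds (x := ψ x • L)).add hlim
    rw [add_zero] at this
    refine this.congr' ?_
    filter_upwards [eventually_ne_atTop 0] with N hN
    exact (hsum N hN).symm

end BoundedOrbits

/-! ### The Perron–Frobenius theorem -/

section PerronFrobenius

variable {A : Type*} [CStarAlgebra A] [PartialOrder A] [StarOrderedRing A]
  {τ : Module.End ℂ A}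

/-- The Collatz–Wielandt argument: `r` is the largest `t` such that `t X ≤ τ X` for some positive
`X` of norm one. If `τ X - r X` were non-zero, then applying `orbitSum τ` would make it strictly
positive and `r` could be increased. -/
theorem IsIrreducibleMap.exists_strictlyPositive_eigenvector [FiniteDimensional ℂ A]
    (hirr : IsIrreducibleMap τ) (hpos : ∀ X, 0 ≤ X → 0 ≤ τ X) (hτ : τ ≠ 0) :
    ∃ r : ℝ, 0 < r ∧ ∃ L : A, IsStrictlyPositive L ∧ τ L = r • L := by
  have : Nontrivial A := by
    by_contra h
    rw [not_nontrivial_iff_subsingleton] at h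
    exact hτ (Subsingleton.elim _ _)
  have : ProperSpace A := FiniteDimensional.proper ℂ A
  have hcont : Continuous τ := τ.continuous_of_finiteDimensional
  let τc : A →L[ℂ] A := ⟨τ, hcont⟩
  let K : Set (ℝ × A) := {q | 0 ≤ q.1 ∧ 0 ≤ q.2 ∧ ‖q.2‖ = 1 ∧ q.1 • q.2 ≤ τ q.2}
  have hKclosed : IsClosed K := by
    refine (isClosed_le continuous_const continuous_fst).inter
      ((isClosed_le continuous_const continuous_snd).inter
        ((isClosed_eq (continuous_snd.norm) continuous_const).inter
          (isClosed_le (continuous_fst.smul continuous_snd) (hcont.comp continuous_snd))))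
  have hKsub : K ⊆ Set.Icc 0 ‖τc‖ ×ˢ Metric.sphere (0 : A) 1 := by
    rintro ⟨t, X⟩ ⟨ht, hX, hX1, htX⟩
    refine ⟨⟨ht, ?_⟩, by simpa using hX1⟩
    have h1 : ‖t • X‖ ≤ ‖τc X‖ :=
      CStarAlgebra.norm_le_norm_of_nonneg_of_le (smul_nonneg ht hX) htX
    have h2 := τc.le_opNorm X
    simp only at hX1
    rw [norm_smul, hX1, mul_one, Real.norm_of_nonneg ht] at h1
    rw [hX1, mul_one] at h2
    exact h1.trans h2
  have hKcompact : IsCompact K :=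
    (isCompact_Icc.prod (isCompact_sphere _ _)).of_isClosed_subset hKclosed hKsub
  have hKne : K.Nonempty :=
    ⟨(0, 1), le_rfl, zero_le_one, by simp, by simpa using hpos 1 zero_le_one⟩
  obtain ⟨⟨r, X⟩, ⟨hr, hX, hX1, hrX⟩, hmax⟩ :=
    hKcompact.exists_isMaxOn hKne continuous_fst.continuousOn
  simp only at hr hX hX1 hrX
  have hX0 : X ≠ 0 := by rintro rfl; simp at hX1
  have hmax' : ∀ (t : ℝ) (Y : A), 0 ≤ t → 0 ≤ Y → Y ≠ 0 → t • Y ≤ τ Y → t ≤ r := by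
    intro t Y ht hY hY0 htY
    have hn : 0 < ‖Y‖ := norm_pos_iff.2 hY0
    refine hmax (a := (t, ‖Y‖⁻¹ • Y)) ⟨ht, smul_nonneg (by positivity) hY, ?_, ?_⟩
    · simp [norm_smul, hn.ne']
    · simp only
      rw [LinearMap.map_smul_of_tower, smul_comm]
      exact smul_le_smul_of_nonneg_left htY (by positivity)
  have hstrict := hirr.isStrictlyPositive_orbitSum hpos
  have hXe : τ X = r • X := by
    by_contra hne
    have hZ := hstrict _ (sub_nonneg.2 hrX) (sub_ne_zero.2 hne)
    have hY := hstrict X hX hX0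
    obtain ⟨C, hC, hYC⟩ := hY.nonneg.isSelfAdjoint.exists_le_smul_of_isStrictlyPositive hZ
    rw [map_sub, orbitSum_comm, LinearMap.map_smul_of_tower] at hYC
    have hle : (r + C⁻¹) • orbitSum τ X ≤ τ (orbitSum τ X) := by
      have := (inv_smul_le_iff_of_pos hC).2 hYC
      rw [add_smul, add_comm]
      exact le_sub_iff_add_le.1 this
    have := hmax' _ _ (by positivity) hY.nonneg hY.isUnit.ne_zero hle
    have : 0 < C⁻¹ := by positivity
    linarith
  have hLpos : IsStrictlyPositive X := hirr.isStrictlyPositive_of_apply_le hpos hX hX0 hr hXe.le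
  refine ⟨r, lt_of_le_of_ne hr ?_, X, hLpos, hXe⟩
  -- if `r = 0`, then `τ` annihilates an order unit
  rintro rfl
  apply hτ
  ext Y
  have hY : Y ∈ Submodule.span ℂ {a : A | 0 ≤ a} := by
    rw [CStarAlgebra.span_nonneg]; trivial
  induction hY using Submodule.span_induction with
  | mem Y hY =>
    have hY' : 0 ≤ Y := hY
    obtain ⟨C, hC, hYC⟩ := hY'.isSelfAdjoint.exists_le_smul_of_isStrictlyPositive hLpos
    have := LinearMap.map_le_map_of_nonneg hpos hYC
    rw [LinearMap.map_smul_of_tower, hXe, zero_smul, smul_zero] at this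
    exact le_antisymm this (hpos _ hY')
  | zero => simp
  | add X Z _ _ hX hZ => simp_all
  | smul c X _ hX => simp_all

/-- Orbits are `O(r ^ n)`: a positive `X` is dominated by a multiple of the eigenvector `L`, and the
positive elements span the algebra. -/
theorem exists_norm_pow_apply_le (hpos : ∀ X, 0 ≤ X → 0 ≤ τ X) {r : ℝ} (hr : 0 < r) {L : A}
    (hL : IsStrictlyPositive L) (hLe : τ L = r • L) (X : A) :
    ∃ C, ∀ n, ‖(τ ^ n) X‖ ≤ C * r ^ n := by
  have hX : X ∈ Submodule.span ℂ {a : A | 0 ≤ a} := by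
    rw [CStarAlgebra.span_nonneg]; trivial
  induction hX using Submodule.span_induction with
  | mem X hX =>
    have hX' : 0 ≤ X := hX
    obtain ⟨C, hC, hXC⟩ := hX'.isSelfAdjoint.exists_le_smul_of_isStrictlyPositive hL
    refine ⟨C * ‖L‖, fun n => ?_⟩
    have h1 : (τ ^ n) X ≤ (τ ^ n) (C • L) := LinearMap.map_le_map_of_nonneg
      (fun Y hY => LinearMap.pow_nonneg_of_nonneg hpos n hY) hXC
    rw [LinearMap.map_smul_of_tower, LinearMap.pow_apply_of_apply_eq_smul hLe] at h1
    refine (CStarAlgebra.norm_le_norm_of_nonneg_of_le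
      (LinearMap.pow_nonneg_of_nonneg hpos n hX') h1).trans ?_
    rw [norm_smul, norm_smul, Real.norm_of_nonneg hC.le, Real.norm_of_nonneg (by positivity)]
    exact le_of_eq (by ring)
  | zero => exact ⟨0, by simp⟩
  | add X Z _ _ hX hZ =>
    obtain ⟨C, hC⟩ := hX
    obtain ⟨C', hC'⟩ := hZ
    refine ⟨C + C', fun n => ?_⟩
    rw [map_add, add_mul]
    exact (norm_add_le _ _).trans (add_le_add (hC n) (hC' n))
  | smul c X _ hX =>
    obtain ⟨C, hC⟩ := hX
    refine ⟨‖c‖ * C, fun n => ?_⟩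
    rw [map_smul, norm_smul, mul_assoc]
    exact mul_le_mul_of_nonneg_left (hC n) (norm_nonneg _)

theorem LinearMap.map_star_of_nonneg {B : Type*} [CStarAlgebra B] [PartialOrder B]
    [StarOrderedRing B] {f : A →ₗ[ℂ] B} (hpos : ∀ X, 0 ≤ X → 0 ≤ f X) (X : A) :
    f (star X) = star (f X) := by
  have hX : X ∈ Submodule.span ℂ {a : A | 0 ≤ a} := by
    rw [CStarAlgebra.span_nonneg]; trivial
  induction hX using Submodule.span_induction with
  | mem X hX =>
    have hX' : 0 ≤ X := hX
    rw [hX'.isSelfAdjoint.star_eq, (hpos _ hX').isSelfAdjoint.star_eq]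
  | zero => simp
  | add X Z _ _ hX hZ => simp_all
  | smul c X _ hX => simp_all

/-- A self-adjoint eigenvector `X` for the eigenvalue of `L` is a multiple of `L`: for the least
`s` with `X ≤ s L`, the eigenvector `s L - X` is positive but not strictly positive. -/
theorem IsIrreducibleMap.exists_eq_smul_of_isSelfAdjoint [FiniteDimensional ℂ A]
    (hirr : IsIrreducibleMap τ) (hpos : ∀ X, 0 ≤ X → 0 ≤ τ X) {r : ℝ} (hr : 0 < r) {L : A}
    (hL : IsStrictlyPositive L) (hLe : τ L = r • L) {X : A} (hX : IsSelfAdjoint X)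
    (hXe : τ X = r • X) : ∃ s : ℝ, X = s • L := by
  rcases subsingleton_or_nontrivial A with _ | _
  · exact ⟨0, Subsingleton.elim _ _⟩
  have hL0 : L ≠ 0 := hL.isUnit.ne_zero
  let S : Set ℝ := {s | X ≤ s • L}
  have hSne : S.Nonempty := by
    obtain ⟨C, _, hC⟩ := hX.exists_le_smul_of_isStrictlyPositive hL
    exact ⟨C, hC⟩
  have hSclosed : IsClosed S :=
    isClosed_le continuous_const (continuous_id.smul continuous_const)
  have hSbdd : BddBelow S := by
    obtain ⟨C, _, hC⟩ := hX.neg.exists_le_smul_of_isStrictlyPositive hL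
    refine ⟨-C, fun s hs => ?_⟩
    by_contra hlt
    push Not at hlt
    have h1 : 0 ≤ (s + C) • L := by
      rw [add_smul]
      have := add_le_add (show X ≤ s • L from hs) hC
      rwa [add_neg_cancel] at this
    have h2 : 0 ≤ (-(s + C)) • L := smul_nonneg (by linarith) hL.nonneg
    rw [neg_smul, Left.nonneg_neg_iff] at h2
    have := smul_eq_zero.1 (le_antisymm h2 h1)
    rcases this with h | h
    · linarith
    · exact hL0 h
  have hs : X ≤ sInf S • L := hSclosed.csInf_mem hSne hSbdd
  refine ⟨sInf S, ?_⟩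
  by_contra hne
  have hY : 0 ≤ sInf S • L - X := sub_nonneg.2 hs
  have hYe : τ (sInf S • L - X) = r • (sInf S • L - X) := by
    rw [map_sub, LinearMap.map_smul_of_tower, hLe, hXe, smul_sub, smul_comm]
  have hYpos := hirr.isStrictlyPositive_of_apply_le hpos hY (sub_ne_zero.2 (Ne.symm hne)) hr.le
    hYe.le
  obtain ⟨C, hC, hLC⟩ := hL.nonneg.isSelfAdjoint.exists_le_smul_of_isStrictlyPositive hYpos
  have h1 : C⁻¹ • L ≤ sInf S • L - X := (inv_smul_le_iff_of_pos hC).2 hLC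
  have h2 : X ≤ (sInf S - C⁻¹) • L := by
    rw [sub_smul]; exact le_sub_comm.1 h1
  have h3 := csInf_le hSbdd h2
  have : 0 < C⁻¹ := by positivity
  linarith

theorem IsIrreducibleMap.exists_eq_smul [FiniteDimensional ℂ A]
    (hirr : IsIrreducibleMap τ) (hpos : ∀ X, 0 ≤ X → 0 ≤ τ X) {r : ℝ} (hr : 0 < r) {L : A}
    (hL : IsStrictlyPositive L) (hLe : τ L = r • L) {X : A} (hXe : τ X = r • X) :
    ∃ c : ℂ, X = c • L := by
  have hXs : τ (star X) = r • star X := by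
    rw [LinearMap.map_star_of_nonneg hpos, hXe, star_smul, star_trivial]
  obtain ⟨s, hs⟩ := hirr.exists_eq_smul_of_isSelfAdjoint hpos hr hL hLe
    (IsSelfAdjoint.add_star_self X) (by rw [map_add, hXe, hXs, smul_add])
  obtain ⟨t, ht⟩ := hirr.exists_eq_smul_of_isSelfAdjoint hpos hr hL hLe
    (X := Complex.I • (X - star X))
    (by simp [IsSelfAdjoint, star_smul, ← smul_neg])
    (by rw [map_smul, map_sub, hXe, hXs, ← smul_sub, smul_comm])
  refine ⟨(1 / 2 : ℂ) * (s - Complex.I * t), ?_⟩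
  have h1 : X = (1 / 2 : ℂ) • ((X + star X) - Complex.I • (Complex.I • (X - star X))) := by
    rw [smul_smul, Complex.I_mul_I]; module
  rw [h1, hs, ht, ← Complex.coe_smul s, ← Complex.coe_smul t]
  module

theorem nonneg_of_smul_nonneg {L : A} (hL : 0 ≤ L) (hL0 : L ≠ 0) {z : ℂ} (hz : 0 ≤ z • L) :
    0 ≤ z := by
  have h1 : star z • L = z • L := by
    have := hz.isSelfAdjoint.star_eq
    rwa [star_smul, hL.isSelfAdjoint.star_eq] at this
  have h2 : star z = z := smul_left_injective ℂ hL0 h1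
  obtain ⟨t, rfl⟩ : ∃ t : ℝ, (t : ℂ) = z := ⟨z.re, Complex.conj_eq_iff_re.1 h2⟩
  rw [Complex.coe_smul] at hz
  by_contra hlt
  have ht : t < 0 := by
    by_contra h; exact hlt (by exact_mod_cast not_lt.1 h)
  have h3 : 0 ≤ (-t) • L := smul_nonneg (by linarith) hL
  rw [neg_smul, Left.nonneg_neg_iff] at h3
  rcases smul_eq_zero.1 (le_antisymm h3 hz) with h | h
  · exact ht.ne h
  · exact hL0 h

/-- The Perron–Frobenius theorem for an irreducible positive map on a finite-dimensional
`C⋆`-algebra, together with the convergence of the Cesàro means of `r ^ (-n) τ ^ n`. -/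
theorem IsIrreducibleMap.perronFrobenius [FiniteDimensional ℂ A]
    (hirr : IsIrreducibleMap τ) (hpos : ∀ X, 0 ≤ X → 0 ≤ τ X) (hτ : τ ≠ 0) :
    ∃ (r : ℝ) (ψ : A →ₗ[ℂ] ℂ) (L : A), 0 < r ∧ IsFaithfulState ψ ∧ IsStrictlyPositive L ∧
      τ L = (r : ℂ) • L ∧ ψ L = 1 ∧ (∀ X, ψ (τ X) = r * ψ X) ∧
      (∀ X, ∃ C, ∀ n, ‖(τ ^ n) X‖ ≤ C * r ^ n) ∧
      ∀ X, Tendsto (fun N : ℕ => (N : ℂ)⁻¹ • ∑ n ∈ Finset.Icc 1 N,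
        ((r : ℂ) ^ n)⁻¹ • (τ ^ n) X) atTop (𝓝 (ψ X • L)) := by
  obtain ⟨r, hr, L, hL, hLe⟩ := hirr.exists_strictlyPositive_eigenvector hpos hτ
  have : Nontrivial A := by
    by_contra h
    rw [not_nontrivial_iff_subsingleton] at h
    exact hτ (Subsingleton.elim _ _)
  have hL0 : L ≠ 0 := hL.isUnit.ne_zero
  have hb := exists_norm_pow_apply_le hpos hr hL hLe
  have hLe' : τ L = (r : ℂ) • L := by rw [hLe, Complex.coe_smul]
  obtain ⟨ψ, hψL, hψτ, hlim⟩ := exists_functional_tendsto_cesaro hr hb hL0 hLe'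
    fun X hX => hirr.exists_eq_smul hpos hr hL hLe (by rw [hX, Complex.coe_smul])
  have hψpos : ∀ X, 0 ≤ X → 0 ≤ ψ X := by
    intro X hX
    refine nonneg_of_smul_nonneg hL.nonneg hL0 (ge_of_tendsto' (hlim X) fun N => ?_)
    have h1 : ((N : ℂ))⁻¹ = ((N : ℝ)⁻¹ : ℝ) := by push_cast; rfl
    rw [h1, Complex.coe_smul]
    refine smul_nonneg (by positivity) (Finset.sum_nonneg fun n _ => ?_)
    have h2 : ((r : ℂ) ^ n)⁻¹ = ((r ^ n)⁻¹ : ℝ) := by push_cast; rfl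
    rw [h2, Complex.coe_smul]
    exact smul_nonneg (by positivity) (LinearMap.pow_nonneg_of_nonneg hpos n hX)
  have hψpow := LinearMap.apply_pow_of_apply_eq hψτ
  -- `orbitSum τ X` dominates a multiple of `L`, and `ψ (orbitSum τ X)` is a multiple of `ψ X`
  have hψf : ∀ X, 0 ≤ X → ψ X = 0 → X = 0 := by
    intro X hX h0
    by_contra hX0
    obtain ⟨C, hC, hLC⟩ := hL.nonneg.isSelfAdjoint.exists_le_smul_of_isStrictlyPositive
      (hirr.isStrictlyPositive_orbitSum hpos X hX hX0)
    have h1 := hψpos _ (sub_nonneg.2 hLC)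
    rw [map_sub, LinearMap.map_smul_of_tower, orbitSum_apply, map_sum] at h1
    simp only [hψpow, h0, hψL, mul_zero, Finset.sum_const_zero, smul_zero] at h1
    norm_num at h1
  -- rescale `ψ` to a state, and `L` by the inverse factor
  have h1pos : 0 ≤ ψ 1 := hψpos 1 zero_le_one
  have h1ne : ψ 1 ≠ 0 := fun h => one_ne_zero (hψf 1 zero_le_one h)
  obtain ⟨a, ha⟩ : ∃ a : ℝ, (a : ℂ) = ψ 1 :=
    ⟨(ψ 1).re, Complex.conj_eq_iff_re.1 h1pos.isSelfAdjoint.star_eq⟩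
  have ha0 : 0 < a := by
    refine lt_of_le_of_ne ?_ ?_
    · rw [← ha] at h1pos; exact_mod_cast h1pos
    · rintro rfl; exact h1ne (by rw [← ha]; simp)
  have hinv : (ψ 1)⁻¹ = ((a⁻¹ : ℝ) : ℂ) := by rw [← ha]; push_cast; rfl
  refine ⟨r, (ψ 1)⁻¹ • ψ, ψ 1 • L, hr, ⟨fun X hX => ?_, ?_, fun X hX h => ?_⟩, ⟨?_, ?_⟩, ?_, ?_,
    fun X => ?_, hb, fun X => ?_⟩
  · rw [LinearMap.smul_apply, hinv, Complex.coe_smul]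
    exact smul_nonneg (by positivity) (hψpos X hX)
  · simp [h1ne]
  · refine hψf X hX ?_
    simpa [h1ne] using h
  · rw [← ha, Complex.coe_smul]
    exact smul_nonneg ha0.le hL.nonneg
  · exact hL.isUnit.smul (Units.mk0 (ψ 1) h1ne)
  · rw [map_smul, hLe', smul_comm]
  · simp [hψL, h1ne]
  · simp only [LinearMap.smul_apply, hψτ, smul_eq_mul]; ring
  · have : ((ψ 1)⁻¹ • ψ) X • ψ 1 • L = ψ X • L := by
      rw [LinearMap.smul_apply, smul_smul, smul_eq_mul]
      congr 1
      field_simp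
    rw [this]
    exact hlim X

end PerronFrobenius

/-! ### Jordan bases and the maximal part -/

section Jordan

variable {V : Type*} [NormedAddCommGroup V] [NormedSpace ℂ V] {φ : Module.End ℂ V} {r : ℝ}

theorem norm_le_of_hasEigenvalue (hr : 0 < r) (hb : ∀ x, ∃ C, ∀ n, ‖(φ ^ n) x‖ ≤ C * r ^ n)
    {c : ℂ} (hc : φ.HasEigenvalue c) : ‖c‖ ≤ r := by
  obtain ⟨x, hx⟩ := hc.exists_hasEigenvector
  obtain ⟨C, hC⟩ := hb x
  have hx0 : 0 < ‖x‖ := norm_pos_iff.2 hx.2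
  by_contra! hlt
  have h1 : 1 < ‖c‖ / r := by rwa [one_lt_div hr]
  obtain ⟨n, hn⟩ := pow_unbounded_of_one_lt (C / ‖x‖) h1
  have h2 := hC n
  rw [pow_apply_of_apply_eq hx.apply_eq_smul, norm_smul, norm_pow] at h2
  rw [div_pow, div_lt_div_iff₀ hx0 (by positivity)] at hn
  linarith

theorem specRadius_eq_of_hasEigenvalue [FiniteDimensional ℂ V] (hr : 0 < r)
    (hb : ∀ x, ∃ C, ∀ n, ‖(φ ^ n) x‖ ≤ C * r ^ n) (hre : φ.HasEigenvalue (r : ℂ)) :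
    specRadius φ = r := by
  have h : spectralRadius ℂ φ = ENNReal.ofReal r := by
    refine le_antisymm (iSup₂_le fun c hc => ?_) ?_
    · rw [← Module.End.hasEigenvalue_iff_mem_spectrum] at hc
      rw [← enorm_eq_nnnorm, ← ofReal_norm]
      exact ENNReal.ofReal_le_ofReal (norm_le_of_hasEigenvalue hr hb hc)
    · have h1 : ENNReal.ofReal r = ‖(r : ℂ)‖₊ := by
        rw [← enorm_eq_nnnorm, ← ofReal_norm, Complex.norm_real, Real.norm_of_nonneg hr.le]
      rw [h1]
      exact le_iSup₂ (f := fun (k : ℂ) (_ : k ∈ spectrum ℂ φ) => (‖k‖₊ : ENNReal)) (r : ℂ)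
        (Module.End.hasEigenvalue_iff_mem_spectrum.1 hre)
  rw [specRadius, h, ENNReal.toReal_ofReal hr.le]

open Polynomial in
theorem degeneracyIndex_eq_one [FiniteDimensional ℂ V] (hr : 0 < r)
    (hb : ∀ x, ∃ C, ∀ n, ‖(φ ^ n) x‖ ≤ C * r ^ n) {c : ℂ} (hc : φ.HasEigenvalue c)
    (hcr : ‖c‖ = r) : degeneracyIndex φ c = 1 := by
  have hm0 : minpoly ℂ φ ≠ 0 := minpoly.ne_zero (Algebra.IsIntegral.isIntegral φ)
  refine le_antisymm ?_ ?_
  · by_contra! hlt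
    obtain ⟨q, hq⟩ : (X - C c) ^ 2 ∣ minpoly ℂ φ :=
      (le_rootMultiplicity_iff hm0).1 (show 2 ≤ _ from hlt)
    -- `(φ - c) q(φ)` vanishes, which contradicts the minimality of the degree
    have hzero : aeval φ ((X - C c) * q) = 0 := by
      ext x
      set y := aeval φ q x with hy
      have h0 : aeval φ ((X - C c) ^ 2 * q) x = 0 := by
        rw [← hq, minpoly.aeval, LinearMap.zero_apply]
      have hap : ∀ z, aeval φ (X - C c) z = φ z - c • z := fun z => by simp
      rw [pow_two, mul_assoc, map_mul, map_mul, Module.End.mul_apply, Module.End.mul_apply,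
        ← hy, hap, hap] at h0
      rw [map_mul, Module.End.mul_apply, ← hy, hap]
      exact eq_zero_of_jordanChain hr hb hcr (v := y) (by abel) (sub_eq_zero.1 h0)
    have hdvd := minpoly.dvd ℂ φ hzero
    have hq0 : q ≠ 0 := by rintro rfl; exact hm0 (by rw [hq, mul_zero])
    have hne : (X - C c) * q ≠ 0 := mul_ne_zero (X_sub_C_ne_zero c) hq0
    have hdeg := natDegree_le_of_dvd hdvd hne
    rw [hq, natDegree_mul (pow_ne_zero _ (X_sub_C_ne_zero c)) hq0,
      natDegree_mul (X_sub_C_ne_zero c) hq0, natDegree_pow, natDegree_X_sub_C] at hdeg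
    omega
  · exact (rootMultiplicity_pos hm0).2 (Module.End.isRoot_of_hasEigenvalue hc)

theorem maxDegeneracyIndex_eq_one [FiniteDimensional ℂ V] (hr : 0 < r)
    (hb : ∀ x, ∃ C, ∀ n, ‖(φ ^ n) x‖ ≤ C * r ^ n) (hre : φ.HasEigenvalue (r : ℂ)) :
    maxDegeneracyIndex φ = 1 := by
  have hs := specRadius_eq_of_hasEigenvalue hr hb hre
  have : {k | ∃ c : ℂ, φ.HasEigenvalue c ∧ ‖c‖ = specRadius φ ∧ degeneracyIndex φ c = k} = {1} := by
    ext k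
    constructor
    · rintro ⟨c, hc, hcr, rfl⟩
      exact degeneracyIndex_eq_one hr hb hc (hcr.trans hs)
    · rintro rfl
      have hn : ‖(r : ℂ)‖ = r := by rw [Complex.norm_real, Real.norm_of_nonneg hr.le]
      exact ⟨r, hre, hn.trans hs.symm, degeneracyIndex_eq_one hr hb hre hn⟩
  rw [maxDegeneracyIndex, this, csSup_singleton]

theorem JordanBasis.hasEigenvalue_eig (β : JordanBasis φ) (k : Fin β.blocks)
    (hk : 0 < β.size k) : φ.HasEigenvalue (β.eig k) := by
  refine Module.End.hasEigenvalue_of_hasEigenvector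
    (x := β.basis ⟨k, ⟨β.size k - 1, by omega⟩⟩) ⟨?_, β.basis.ne_zero _⟩
  rw [Module.End.mem_eigenspace_iff, β.apply_basis, dif_neg (by simp; omega), add_zero]

/-- On a Jordan chain with eigenvalue of modulus less than `q`, the powers of `φ` are
`O(q ^ n)`. -/
theorem JordanBasis.exists_norm_pow_apply_le (β : JordanBasis φ) (k : Fin β.blocks) {q : ℝ}
    (hq : ‖β.eig k‖ < q) (m : ℕ) (j : Fin (β.size k)) (hm : β.size k - j ≤ m) :
    ∃ C, ∀ n, ‖(φ ^ n) (β.basis ⟨k, j⟩)‖ ≤ C * q ^ n := by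
  have hq0 : 0 < q := (norm_nonneg _).trans_lt hq
  induction m generalizing j with
  | zero => have := j.2; omega
  | succ m ih =>
    obtain ⟨C, hC0, hC⟩ : ∃ C, 0 ≤ C ∧ ∀ n, ‖(φ ^ n) (φ (β.basis ⟨k, j⟩) -
        β.eig k • β.basis ⟨k, j⟩)‖ ≤ C * q ^ n := by
      rw [β.apply_basis, add_sub_cancel_left]
      split_ifs with h
      · obtain ⟨C, hC⟩ := ih ⟨j + 1, h⟩ (by simp only; omega)
        refine ⟨C, ?_, hC⟩
        simpa using (norm_nonneg _).trans (hC 0)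
      · exact ⟨0, le_rfl, by simp⟩
    set b := β.basis ⟨k, j⟩ with hb
    set c := β.eig k
    have hd : 0 < q - ‖c‖ := sub_pos.2 hq
    refine ⟨max ‖b‖ (C / (q - ‖c‖)), fun n => ?_⟩
    induction n with
    | zero => simp
    | succ n ihn =>
      have hstep : (φ ^ (n + 1)) b = c • (φ ^ n) b + (φ ^ n) (φ b - c • b) := by
        rw [pow_succ, Module.End.mul_apply, map_sub, map_smul]; abel
      have hCM : C ≤ max ‖b‖ (C / (q - ‖c‖)) * (q - ‖c‖) := by
        rw [← div_le_iff₀ hd]; exact le_max_right _ _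
      calc ‖(φ ^ (n + 1)) b‖ ≤ ‖c‖ * ‖(φ ^ n) b‖ + ‖(φ ^ n) (φ b - c • b)‖ := by
            rw [hstep, ← norm_smul]; exact norm_add_le _ _
        _ ≤ ‖c‖ * (max ‖b‖ (C / (q - ‖c‖)) * q ^ n) +
              (max ‖b‖ (C / (q - ‖c‖)) * (q - ‖c‖)) * q ^ n := by
            refine add_le_add (mul_le_mul_of_nonneg_left ihn (norm_nonneg _)) ((hC n).trans ?_)
            exact mul_le_mul_of_nonneg_right hCM (by positivity)
        _ = max ‖b‖ (C / (q - ‖c‖)) * q ^ (n + 1) := by rw [pow_succ]; ring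

theorem JordanBasis.tendsto_pow_apply (β : JordanBasis φ) (hr : 0 < r) (k : Fin β.blocks)
    (hk : ‖β.eig k‖ < r) (j : Fin (β.size k)) :
    Tendsto (fun n => ((r : ℂ) ^ n)⁻¹ • (φ ^ n) (β.basis ⟨k, j⟩)) atTop (𝓝 0) := by
  obtain ⟨q, hkq, hqr⟩ := exists_between hk
  have hq0 : 0 ≤ q := (norm_nonneg _).trans hkq.le
  obtain ⟨C, hC⟩ := β.exists_norm_pow_apply_le k hkq _ j le_rfl
  refine squeeze_zero_norm (a := fun n => C * (q / r) ^ n) (fun n => ?_) ?_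
  · rw [norm_smul, norm_inv, norm_pow, Complex.norm_real, Real.norm_of_nonneg hr.le,
      inv_mul_le_iff₀ (by positivity)]
    refine (hC n).trans_eq ?_
    rw [div_pow]; field_simp
  · simpa using (tendsto_pow_atTop_nhds_zero_of_lt_one (by positivity)
      ((div_lt_one hr).2 hqr)).const_mul C

/-- The chains of eigenvalues of modulus `r` have length one. -/
theorem JordanBasis.apply_basis_of_norm_eig_eq (β : JordanBasis φ) (hr : 0 < r)
    (hb : ∀ x, ∃ C, ∀ n, ‖(φ ^ n) x‖ ≤ C * r ^ n) (k : Fin β.blocks) (hk : ‖β.eig k‖ = r)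
    (j : Fin (β.size k)) : φ (β.basis ⟨k, j⟩) = β.eig k • β.basis ⟨k, j⟩ := by
  have hsize : β.size k ≤ 1 := by
    by_contra! h
    refine β.basis.ne_zero ⟨k, ⟨β.size k - 1, by omega⟩⟩
      (eq_zero_of_jordanChain hr hb hk (v := β.basis ⟨k, ⟨β.size k - 2, by omega⟩⟩) ?_ ?_)
    · rw [β.apply_basis, dif_pos (by simp only; omega)]
      congr 4
      simp only; omega
    · rw [β.apply_basis, dif_neg (by simp only; omega), add_zero]
  rw [β.apply_basis, dif_neg (by omega), add_zero]

/-- If `r` is an eigenvalue, then some non-empty Jordan chain has an eigenvalue of modulus `r`. -/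
theorem JordanBasis.exists_norm_eig_eq [FiniteDimensional ℂ V] (β : JordanBasis φ) (hr : 0 < r)
    (hb : ∀ x, ∃ C, ∀ n, ‖(φ ^ n) x‖ ≤ C * r ^ n) (hre : φ.HasEigenvalue (r : ℂ)) :
    ∃ k, 0 < β.size k ∧ ‖β.eig k‖ = r := by
  by_contra! hne
  obtain ⟨L, hL⟩ := hre.exists_hasEigenvector
  have hlt : ∀ k, 0 < β.size k → ‖β.eig k‖ < r := fun k hk =>
    lt_of_le_of_ne (norm_le_of_hasEigenvalue hr hb (β.hasEigenvalue_eig k hk)) (hne k hk)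
  have h1 : Tendsto (fun n => ((r : ℂ) ^ n)⁻¹ • (φ ^ n) L) atTop (𝓝 0) := by
    have h2 : Tendsto (fun n => ∑ i, β.basis.repr L i • ((r : ℂ) ^ n)⁻¹ • (φ ^ n) (β.basis i))
        atTop (𝓝 (∑ i, β.basis.repr L i • (0 : V))) := by
      refine tendsto_finsetSum _ fun i _ => Tendsto.const_smul ?_ _
      exact β.tendsto_pow_apply hr i.1 (hlt i.1 (by have := i.2.2; omega)) i.2
    simp only [smul_zero, Finset.sum_const_zero] at h2
    refine h2.congr fun n => ?_
    conv_rhs => rw [← β.basis.sum_repr L]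
    simp only [map_sum, map_smul, Finset.smul_sum]
    exact Finset.sum_congr rfl fun i _ => smul_comm _ _ _
  have h3 : ∀ n : ℕ, ((r : ℂ) ^ n)⁻¹ • (φ ^ n) L = L := fun n => by
    rw [pow_apply_of_apply_eq hL.apply_eq_smul, inv_smul_smul₀]
    exact pow_ne_zero _ (by exact_mod_cast hr.ne')
  simp only [h3] at h1
  exact hL.2 (tendsto_nhds_unique tendsto_const_nhds h1)

/-- For large `n` the largest entry of the matrix of `φ ^ n` in a Jordan basis has modulus exactly
`r ^ n`: it is attained on the chains of eigenvalues of modulus `r`, which have length one, and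
the entries on the other chains are `o(r ^ n)`. -/
theorem JordanBasis.eventually_norm_pow_eq [FiniteDimensional ℂ V] (β : JordanBasis φ) (hr : 0 < r)
    (hb : ∀ x, ∃ C, ∀ n, ‖(φ ^ n) x‖ ≤ C * r ^ n) (hre : φ.HasEigenvalue (r : ℂ)) :
    ∀ᶠ n in atTop, β.norm (φ ^ n) = r ^ n := by
  classical
  have hent : ∀ (n : ℕ) (p : (Σ k, Fin (β.size k)) × (Σ k, Fin (β.size k))),
      ‖LinearMap.toMatrix β.basis β.basis (φ ^ n) p.1 p.2‖ =
      ‖β.basis.repr ((φ ^ n) (β.basis p.2)) p.1‖ := fun n p => by rw [LinearMap.toMatrix_apply]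
  have hdiag : ∀ (n : ℕ) (p : (Σ k, Fin (β.size k)) × (Σ k, Fin (β.size k))),
      ‖β.eig p.2.1‖ = r →
      ‖LinearMap.toMatrix β.basis β.basis (φ ^ n) p.1 p.2‖ = if p.2 = p.1 then r ^ n else 0 := by
    intro n p hp
    rw [hent, pow_apply_of_apply_eq (β.apply_basis_of_norm_eig_eq hr hb p.2.1 hp p.2.2), map_smul,
      Module.Basis.repr_self, Finsupp.smul_apply, Finsupp.single_apply]
    split_ifs <;> simp [hp]
  have hle : ∀ p : (Σ k, Fin (β.size k)) × (Σ k, Fin (β.size k)), ∀ᶠ n in atTop,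
      ‖LinearMap.toMatrix β.basis β.basis (φ ^ n) p.1 p.2‖ ≤ r ^ n := by
    intro p
    rcases (norm_le_of_hasEigenvalue hr hb (β.hasEigenvalue_eig p.2.1
      (by have := p.2.2.2; omega))).lt_or_eq with hlt | heq
    · have h1 : Tendsto (fun n => ‖β.basis.coord p.1
          (((r : ℂ) ^ n)⁻¹ • (φ ^ n) (β.basis p.2))‖) atTop (𝓝 0) := by
        have hc : Continuous (β.basis.coord p.1) :=
          LinearMap.continuous_of_finiteDimensional _
        have := ((hc.tendsto 0).comp (β.tendsto_pow_apply hr p.2.1 hlt p.2.2)).norm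
        simpa using this
      filter_upwards [h1.eventually (gt_mem_nhds zero_lt_one)] with n hn
      rw [map_smul, norm_smul, norm_inv, norm_pow, Complex.norm_real, Real.norm_of_nonneg hr.le,
        inv_mul_lt_iff₀ (by positivity), mul_one] at hn
      rw [hent]
      exact hn.le
    · filter_upwards with n
      rw [hdiag n p heq]
      split_ifs
      · exact le_rfl
      · positivity
  obtain ⟨k, hk, hkr⟩ := β.exists_norm_eig_eq hr hb hre
  filter_upwards [eventually_all.2 hle] with n hn
  let i : Σ k, Fin (β.size k) := ⟨k, ⟨0, hk⟩⟩
  have : Nonempty (Σ k, Fin (β.size k)) := ⟨i⟩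
  refine le_antisymm (ciSup_le hn) ?_
  have h1 := hdiag n (i, i) hkr
  rw [if_pos rfl] at h1
  rw [← h1]
  exact le_ciSup (f := fun p : (Σ k, Fin (β.size k)) × (Σ k, Fin (β.size k)) =>
    ‖LinearMap.toMatrix β.basis β.basis (φ ^ n) p.1 p.2‖) (Set.finite_range _).bddAbove (i, i)

/-- The maximal part can be computed with the normalization `r ^ n` in place of `‖φ ^ n‖_β`. -/
theorem isMaximalPart_of_tendsto [FiniteDimensional ℂ V] (hr : 0 < r)
    (hb : ∀ x, ∃ C, ∀ n, ‖(φ ^ n) x‖ ≤ C * r ^ n) (hre : φ.HasEigenvalue (r : ℂ))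
    {φhat : Module.End ℂ V} (h : ∀ x, Tendsto (fun N : ℕ => (N : ℂ)⁻¹ • ∑ n ∈ Finset.Icc 1 N,
        ((r : ℂ) ^ n)⁻¹ • (φ ^ n) x) atTop (𝓝 (φhat x))) : IsMaximalPart φ φhat := by
  refine ⟨by rwa [specRadius_eq_of_hasEigenvalue hr hb hre], fun β x => ?_⟩
  set d : ℕ → V := fun n => ((β.norm (φ ^ n))⁻¹ : ℂ) • (φ ^ n) x - ((r : ℂ) ^ n)⁻¹ • (φ ^ n) x
    with hd
  have hd0 : Tendsto (fun n => d (n + 1)) atTop (𝓝 0) := by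
    refine (tendsto_add_atTop_iff_nat 1).2 (tendsto_const_nhds.congr' ?_)
    filter_upwards [β.eventually_norm_pow_eq hr hb hre] with n hn
    simp [hd, hn]
  have hces := (h x).add hd0.cesaro_smul
  rw [add_zero] at hces
  refine hces.congr fun N => ?_
  have h1 : ((N : ℝ)⁻¹ : ℝ) • ∑ i ∈ Finset.range N, d (i + 1) =
      (N : ℂ)⁻¹ • ∑ n ∈ Finset.Icc 1 N, d n := by
    rw [← Complex.coe_smul]
    push_cast
    rw [Finset.range_eq_Ico, Finset.sum_Ico_add' d 0 N 1, zero_add,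
      ← Finset.Ico_add_one_right_eq_Icc]
  rw [h1, ← smul_add, ← Finset.sum_add_distrib]
  congr 1
  exact Finset.sum_congr rfl fun n _ => by simp [hd]

end Jordan

/-! ### Kraus coefficients -/

section Kraus

variable {I : Type*} [Fintype I] [DecidableEq I]

theorem LinearMap.apply_eq_sum_single (ψ : Matrix I I ℂ →ₗ[ℂ] ℂ) (X : Matrix I I ℂ) :
    ψ X = ∑ i, ∑ j, X i j * ψ (Matrix.single i j 1) := by
  conv_lhs => rw [Matrix.matrix_eq_sum_single X]
  simp only [map_sum]
  refine Finset.sum_congr rfl fun i _ => Finset.sum_congr rfl fun j _ => ?_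
  rw [← smul_eq_mul, ← map_smul, Matrix.smul_single, smul_eq_mul, mul_one]

/-- The density matrix of a faithful positive functional is positive definite. -/
theorem exists_isUnit_apply_eq_trace {ψ : Matrix I I ℂ →ₗ[ℂ] ℂ} (hpos : ∀ X, 0 ≤ X → 0 ≤ ψ X)
    (hfaithful : ∀ X, 0 ≤ X → ψ X = 0 → X = 0) :
    ∃ D : Matrix I I ℂ, IsUnit D ∧ ∀ X, ψ X = (Dᴴ * X * D).trace := by
  let ρ : Matrix I I ℂ := Matrix.of fun i j => ψ (Matrix.single j i 1)
  have hρψ : ∀ X, ψ X = (X * ρ).trace := by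
    intro X
    rw [LinearMap.apply_eq_sum_single]
    simp [Matrix.trace, Matrix.mul_apply, ρ]
  have hherm : ρ.IsHermitian := by
    ext i j
    have h := LinearMap.map_star_of_nonneg hpos (Matrix.single i j 1)
    rw [Matrix.star_eq_conjTranspose, Matrix.conjTranspose_single, star_one] at h
    rw [Matrix.conjTranspose_apply]
    exact h.symm
  have hdef : ρ.PosDef := by
    refine .of_dotProduct_mulVec_pos hherm fun v hv => ?_
    have h1 : star v ⬝ᵥ ρ *ᵥ v = ψ (Matrix.vecMulVec v (star v)) := by
      rw [hρψ, Matrix.vecMulVec_mul, Matrix.trace_vecMulVec, Matrix.dotProduct_mulVec,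
        dotProduct_comm]
    have h2 : 0 ≤ Matrix.vecMulVec v (star v) := (Matrix.posSemidef_vecMulVec_self_star v).nonneg
    rw [h1]
    refine lt_of_le_of_ne (hpos _ h2) fun h0 => hv ?_
    have h3 := hfaithful _ h2 h0.symm
    ext i
    have h4 := congrFun (congrFun h3 i) i
    simpa [Matrix.vecMulVec_apply] using h4
  obtain ⟨D, hD, hρD⟩ := CStarAlgebra.isStrictlyPositive_iff_eq_mul_star_self.1
    (Matrix.isStrictlyPositive_iff_posDef.2 hdef)
  refine ⟨D, hD, fun X => ?_⟩
  rw [hρψ, hρD, Matrix.star_eq_conjTranspose, ← mul_assoc, Matrix.trace_mul_comm, ← mul_assoc]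

theorem sum_single_mul_mul_single (M : Matrix I I ℂ) :
    ∑ p : I × I, (Matrix.single p.1 p.2 (1 : ℂ))ᴴ * M * Matrix.single p.1 p.2 1 =
      M.trace • (1 : Matrix I I ℂ) := by
  simp only [Matrix.conjTranspose_single, star_one, Matrix.single_mul_mul_single, one_mul, mul_one]
  rw [Fintype.sum_prod_type, Finset.sum_comm]
  ext a b
  simp only [Matrix.sum_apply, Matrix.single_apply, Matrix.smul_apply, Matrix.one_apply,
    smul_eq_mul, Matrix.trace, Matrix.diag_apply]
  by_cases hab : a = b
  · subst hab
    simp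
  · rw [if_neg hab, mul_zero]
    refine Finset.sum_eq_zero fun j _ => Finset.sum_eq_zero fun i _ => if_neg ?_
    rintro ⟨rfl, h⟩
    exact hab h

/-- A map `X ↦ ψ X • Cᴴ C` with `C` invertible and `ψ = tr (Dᴴ X D)` faithful has the Kraus
coefficients `D Eᵢⱼ C`, which span the matrix algebra. -/
theorem exists_isChoiKraus_span_eq_top {σ : Module.End ℂ (Matrix I I ℂ)}
    {ψ : Matrix I I ℂ →ₗ[ℂ] ℂ} (hpos : ∀ X, 0 ≤ X → 0 ≤ ψ X)
    (hfaithful : ∀ X, 0 ≤ X → ψ X = 0 → X = 0) {C : Matrix I I ℂ} (hC : IsUnit C)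
    (hσ : ∀ X, σ X = ψ X • (Cᴴ * C)) :
    ∃ (q : ℕ) (B : Fin q → Matrix I I ℂ), IsChoiKraus σ B ∧
      Submodule.span ℂ (Set.range B) = ⊤ := by
  obtain ⟨D, hD, hψ⟩ := exists_isUnit_apply_eq_trace hpos hfaithful
  let e := Fintype.equivFin (I × I)
  let B : I × I → Matrix I I ℂ := fun p => D * Matrix.single p.1 p.2 1 * C
  refine ⟨_, B ∘ e.symm, fun X => ?_, ?_⟩
  · have h1 : ∑ j, ((B ∘ e.symm) j)ᴴ * X * (B ∘ e.symm) j = ∑ p, (B p)ᴴ * X * B p :=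
      e.symm.sum_comp fun p => (B p)ᴴ * X * B p
    have h2 : ∀ p, (B p)ᴴ * X * B p =
        Cᴴ * ((Matrix.single p.1 p.2 (1 : ℂ))ᴴ * (Dᴴ * X * D) * Matrix.single p.1 p.2 1) * C := by
      intro p
      simp only [B, Matrix.conjTranspose_mul, mul_assoc]
    rw [h1, Finset.sum_congr rfl fun p _ => h2 p, ← Finset.sum_mul, ← Finset.mul_sum,
      sum_single_mul_mul_single, hσ, hψ, mul_smul_comm, mul_one, smul_mul_assoc]
  · rw [e.symm.surjective.range_comp, eq_top_iff]
    intro M _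
    obtain ⟨D, rfl⟩ := hD
    obtain ⟨C, rfl⟩ := hC
    have hM : M = ∑ i, ∑ j, ((D⁻¹ : (Matrix I I ℂ)ˣ) * M * (C⁻¹ : (Matrix I I ℂ)ˣ) :
        Matrix I I ℂ) i j • B (i, j) := by
      have h := Matrix.matrix_eq_sum_single
        ((D⁻¹ : (Matrix I I ℂ)ˣ) * M * (C⁻¹ : (Matrix I I ℂ)ˣ) : Matrix I I ℂ)
      have h' := congrArg (fun N => (D : Matrix I I ℂ) * N * C) h
      simp only [Finset.mul_sum, Finset.sum_mul] at h'
      rw [show (D : Matrix I I ℂ) * ((D⁻¹ : (Matrix I I ℂ)ˣ) * M * (C⁻¹ : (Matrix I I ℂ)ˣ)) * C = M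
        by simp [mul_assoc]] at h'
      refine h'.trans (Finset.sum_congr rfl fun i _ => Finset.sum_congr rfl fun j _ => ?_)
      simp only [B]
      rw [← smul_mul_assoc, ← mul_smul_comm, Matrix.smul_single, smul_eq_mul, mul_one]
    rw [hM]
    exact Submodule.sum_mem _ fun i _ => Submodule.sum_mem _ fun j _ =>
      Submodule.smul_mem _ _ (Submodule.subset_span ⟨_, rfl⟩)

theorem choiRank_eq_of_span_eq_top {I : Type*} [Fintype I] {σ : Module.End ℂ (Matrix I I ℂ)} {q : ℕ}
    {B : Fin q → Matrix I I ℂ} (hB : IsChoiKraus σ B)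
    (hspan : Submodule.span ℂ (Set.range B) = ⊤) : choiRank σ = Fintype.card I ^ 2 := by
  have h : coefficientSpace σ = ⊤ := by
    rw [eq_top_iff, ← hspan]
    exact le_iSup_of_le q (le_iSup_of_le B (le_iSup_of_le hB le_rfl))
  rw [choiRank, h, finrank_top, Module.finrank_matrix]
  simp [pow_two]

end Kraus

section Block

theorem IsStrictlyPositive.exists_isUnit_eq_star_mul_self {A : Type*} [CStarAlgebra A]
    [PartialOrder A] [StarOrderedRing A] {L : A} (hL : IsStrictlyPositive L) :
    ∃ C, IsUnit C ∧ L = star C * C :=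
  CStarAlgebra.isStrictlyPositive_iff_eq_star_mul_self.1 hL

variable {d : ℕ} {n : Fin d → ℕ}

/-- The canonical extension of a rank one map `X ↦ ψ X • L` with `ψ` faithful and `L` strictly
positive has Kraus coefficients that span the full matrix algebra. -/
theorem exists_isChoiKraus_canonicalExtension {σ : Module.End ℂ (BlockAlgebra n)}
    {ψ : BlockAlgebra n →ₗ[ℂ] ℂ} (hpos : ∀ X, 0 ≤ X → 0 ≤ ψ X)
    (hfaithful : ∀ X, 0 ≤ X → ψ X = 0 → X = 0) {L : BlockAlgebra n} (hL : IsStrictlyPositive L)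
    (hσ : ∀ X, σ X = ψ X • L) :
    ∃ (q : ℕ) (B : Fin q → FullMatrix n), IsChoiKraus (canonicalExtension σ) B ∧
      Submodule.span ℂ (Set.range B) = ⊤ := by
  obtain ⟨C, hC, hLC⟩ := hL.exists_isUnit_eq_star_mul_self
  let ψ' : FullMatrix n →ₗ[ℂ] ℂ :=
    { toFun := fun X => ψ (Matrix.blockDiag' X)
      map_add' := fun X Y => by rw [Matrix.blockDiag'_add, map_add]
      map_smul' := fun c X => by rw [Matrix.blockDiag'_smul, map_smul, RingHom.id_apply] }
  have hdiag : ∀ X : FullMatrix n, 0 ≤ X → 0 ≤ (Matrix.blockDiag' X : BlockAlgebra n) := by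
    intro X hX i
    exact ((Matrix.nonneg_iff_posSemidef.1 hX).submatrix (fun a => (⟨i, a⟩ : Σ i, Fin (n i)))).nonneg
  refine exists_isChoiKraus_span_eq_top (ψ := ψ') (C := Matrix.blockDiagonal' C)
    (fun X hX => hpos _ (hdiag X hX)) (fun X hX h0 => ?_)
    (hC.map (Matrix.blockDiagonal'RingHom (fun i => Fin (n i)) ℂ)) (fun X => ?_)
  · have h1 := hfaithful _ (hdiag X hX) h0
    rw [← (Matrix.nonneg_iff_posSemidef.1 hX).trace_eq_zero_iff]
    refine Finset.sum_eq_zero fun x _ => ?_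
    exact congrFun (congrFun (congrFun h1 x.1) x.2) x.2
  · change Matrix.blockDiagonal' (σ (Matrix.blockDiag' X)) = ψ (Matrix.blockDiag' X) • _
    rw [hσ, Matrix.blockDiagonal'_smul, hLC, Matrix.blockDiagonal'_conjTranspose,
      ← Matrix.blockDiagonal'_mul]
    rfl

/-- If `m ≥ 2`, the zero map is not irreducible, because the algebra has a non-trivial
projection. -/
theorem IsIrreducibleMap.ne_zero {τ : Module.End ℂ (BlockAlgebra n)} (hirr : IsIrreducibleMap τ)
    (hm : 2 ≤ ∑ i, n i) : τ ≠ 0 := by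
  rintro rfl
  have hcard : 1 < Fintype.card (Σ i, Fin (n i)) := by simp; omega
  obtain ⟨x, y, hxy⟩ := Fintype.one_lt_card_iff.1 hcard
  obtain ⟨i, a⟩ := x
  let p : BlockAlgebra n := Pi.single i (Matrix.single a a 1)
  have hp : IsStarProjection p := by
    constructor
    · rw [IsIdempotentElem, ← Pi.single_mul]
      simp [p]
    · rw [IsSelfAdjoint, Pi.star_def]
      ext j : 1
      by_cases h : j = i
      · subst h; simp [p, Matrix.star_eq_conjTranspose]
      · simp [p, h]
  rcases hirr p hp fun X => ⟨0, by simp⟩ with h | h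
  · have := congrFun (congrFun (congrFun h i) a) a
    simp [p] at this
  · obtain ⟨j, b⟩ := y
    have h1 := congrFun (congrFun (congrFun h j) b) b
    by_cases hij : j = i
    · subst hij
      have hab : a ≠ b := fun h => hxy (by rw [h])
      simp [p, hab] at h1
    · simp [p, hij] at h1

end Block

/-! ### Irreducibility and the maximal part -/

section MaximalPart

variable {A : Type*} [CStarAlgebra A]

/-- Irreducibility passes from the maximal part to the map: an invariant corner `p A p` is closed,
so it is invariant under the limit as well. -/
theorem IsMaximalPart.isIrreducibleMap [FiniteDimensional ℂ A] {τ τhat : Module.End ℂ A}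
    (h : IsMaximalPart τ τhat) (hirr : IsIrreducibleMap τhat) : IsIrreducibleMap τ := by
  intro p hp hinv
  refine hirr p hp fun X => ?_
  let c : Module.End ℂ A := LinearMap.mulLeft ℂ p ∘ₗ LinearMap.mulRight ℂ p
  have hc : ∀ Y, c Y = p * Y * p := fun Y => by simp [c, mul_assoc]
  have hpow : ∀ k : ℕ, (τ ^ k) (p * X * p) ∈ LinearMap.range c := by
    intro k
    induction k with
    | zero => exact ⟨X, hc X⟩
    | succ k ih =>
      obtain ⟨Y, hY⟩ := ih
      obtain ⟨Z, hZ⟩ := hinv Y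
      exact ⟨Z, by rw [pow_succ', Module.End.mul_apply, ← hY, hc, hc, hZ]⟩
  obtain ⟨β⟩ := nonempty_jordanBasis τ
  have hmem : τhat (p * X * p) ∈ LinearMap.range c := by
    refine (Submodule.closed_of_finiteDimensional (LinearMap.range c)).mem_of_tendsto
      (h.2 β (p * X * p)) (Eventually.of_forall fun N => ?_)
    exact Submodule.smul_mem _ _ (Submodule.sum_mem _ fun k _ =>
      Submodule.smul_mem _ _ (hpow k))
  obtain ⟨Y, hY⟩ := hmem
  exact ⟨Y, by rw [← hY, hc]⟩

theorem IsStrictlyPositiveMap.isIrreducibleMap [PartialOrder A] [StarOrderedRing A] {σ : Module.End ℂ A}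
    (h : IsStrictlyPositiveMap σ) : IsIrreducibleMap σ := by
  intro p hp hinv
  by_cases hp0 : p = 0
  · exact Or.inl hp0
  obtain ⟨Y, hY⟩ := hinv p
  rw [hp.isIdempotentElem, hp.isIdempotentElem] at hY
  have hunit := (h p hp.nonneg hp0).isUnit
  right
  refine hunit.mul_left_cancel (?_ : σ p * p = σ p * 1)
  rw [hY, mul_one, mul_assoc, hp.isIdempotentElem]

theorem IsFaithfulState.isStrictlyPositive_smul [PartialOrder A] [StarOrderedRing A] {ψ : A →ₗ[ℂ] ℂ}
    (hψ : IsFaithfulState ψ) {L : A} (hL : IsStrictlyPositive L) {X : A} (hX : 0 ≤ X)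
    (hX0 : X ≠ 0) : IsStrictlyPositive (ψ X • L) := by
  have h0 : ψ X ≠ 0 := fun h => hX0 (hψ.faithful X hX h)
  have hnn := hψ.nonneg X hX
  refine ⟨?_, hL.isUnit.smul (Units.mk0 _ h0)⟩
  obtain ⟨a, ha⟩ : ∃ a : ℝ, (a : ℂ) = ψ X :=
    ⟨(ψ X).re, Complex.conj_eq_iff_re.1 hnn.isSelfAdjoint.star_eq⟩
  rw [← ha] at hnn ⊢
  rw [Complex.coe_smul]
  exact smul_nonneg (by exact_mod_cast hnn) hL.nonneg

end MaximalPart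

theorem mainTheorem1 {d : ℕ} (n : Fin d → ℕ) (τ : BlockAlgebra n →CP BlockAlgebra n)
    (hτ : 2 ≤ ∑ i, n i ∨ τ.toLinearMap ≠ 0) :
    (IsIrreducibleMap τ.toLinearMap ↔
      ∃ τhat : Module.End ℂ (BlockAlgebra n),
        IsMaximalPart τ.toLinearMap τhat ∧ IsIrreducibleMap τhat) ∧
    (IsIrreducibleMap τ.toLinearMap →
      ∃ τhat : Module.End ℂ (BlockAlgebra n), IsMaximalPart τ.toLinearMap τhat ∧
        maxDegeneracyIndex τ.toLinearMap = 1 ∧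
        (IsStrictlyPositiveMap τhat ∧ Module.finrank ℂ (LinearMap.range τhat) = 1) ∧
        (choiRank (canonicalExtension τhat) = (∑ i, n i) ^ 2 ∧
          ∃ (q : ℕ) (B : Fin q → FullMatrix n),
            Submodule.span ℂ (Set.range B) = ⊤ ∧
            ∀ X : BlockAlgebra n, Matrix.blockDiagonal' (τhat X) =
              ∑ j, (B j)ᴴ * Matrix.blockDiagonal' X * B j) ∧
        (∃ (ψ : BlockAlgebra n →ₗ[ℂ] ℂ) (L : BlockAlgebra n),
          IsFaithfulState ψ ∧ IsStrictlyPositive L ∧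
          (∀ X, τhat X = ψ X • L) ∧
          τ.toLinearMap L = (specRadius τ.toLinearMap : ℂ) • L ∧
          ψ L = 1 ∧
          ∀ X, ψ (τ.toLinearMap X) = (specRadius τ.toLinearMap : ℂ) * ψ X) ∧
        (∀ c : ℂ, ‖c‖ < specRadius τ.toLinearMap → ∀ X : BlockAlgebra n, 0 ≤ X →
          X ∈ Module.End.maxGenEigenspace τ.toLinearMap c → X = 0) ∧
        (∀ X : BlockAlgebra n, 0 ≤ X →
          Tendsto (fun k : ℕ => ((specRadius τ.toLinearMap : ℂ) ^ k)⁻¹ • (τ.toLinearMap ^ k) X)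
            atTop (𝓝 0) → X = 0) ∧
        (1 ≤ specRadius τ.toLinearMap → ∀ X : BlockAlgebra n, 0 ≤ X →
          Tendsto (fun k : ℕ => (τ.toLinearMap ^ k) X) atTop (𝓝 0) → X = 0)) := by
  set T : Module.End ℂ (BlockAlgebra n) := τ.toLinearMap with hT
  have hpos : ∀ X, 0 ≤ X → 0 ≤ T X := fun X hX => map_nonneg τ hX
  have key : IsIrreducibleMap T → ∃ (ψ : BlockAlgebra n →ₗ[ℂ] ℂ) (L : BlockAlgebra n)
      (τhat : Module.End ℂ (BlockAlgebra n)), 0 < specRadius T ∧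
      IsFaithfulState ψ ∧ IsStrictlyPositive L ∧ T L = (specRadius T : ℂ) • L ∧ ψ L = 1 ∧
      (∀ X, ψ (T X) = (specRadius T : ℂ) * ψ X) ∧ maxDegeneracyIndex T = 1 ∧
      IsMaximalPart T τhat ∧ ∀ X, τhat X = ψ X • L := by
    intro hirr
    have hT0 : T ≠ 0 := hτ.elim hirr.ne_zero id
    obtain ⟨r, ψ, L, hr, hψ, hL, hTL, hψL, hψT, hb, hlim⟩ := hirr.perronFrobenius hpos hT0
    have hL0 : L ≠ 0 := by rintro rfl; simp at hψL
    have hre : T.HasEigenvalue (r : ℂ) :=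
      Module.End.hasEigenvalue_of_hasEigenvector (x := L)
        ⟨Module.End.mem_eigenspace_iff.2 hTL, hL0⟩
    have hs := specRadius_eq_of_hasEigenvalue hr hb hre
    refine ⟨ψ, L, ψ.smulRight L, by rwa [hs], hψ, hL, by rwa [hs], hψL, by rwa [hs],
      maxDegeneracyIndex_eq_one hr hb hre, isMaximalPart_of_tendsto hr hb hre ?_, fun X => rfl⟩
    exact hlim
  have hstrict : ∀ {ψ : BlockAlgebra n →ₗ[ℂ] ℂ} {L : BlockAlgebra n}
      {τhat : Module.End ℂ (BlockAlgebra n)}, IsFaithfulState ψ → IsStrictlyPositive L →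
      (∀ X, τhat X = ψ X • L) → IsStrictlyPositiveMap τhat := by
    intro ψ L τhat hψ hL hhat X hX hX0
    rw [hhat]
    exact hψ.isStrictlyPositive_smul hL hX hX0
  refine ⟨⟨fun hirr => ?_, fun ⟨τhat, hmax, hirr⟩ => hmax.isIrreducibleMap hirr⟩, fun hirr => ?_⟩
  · obtain ⟨ψ, L, τhat, -, hψ, hL, -, -, -, -, hmax, hhat⟩ := key hirr
    exact ⟨τhat, hmax, (hstrict hψ hL hhat).isIrreducibleMap⟩
  obtain ⟨ψ, L, τhat, hr, hψ, hL, hTL, hψL, hψT, hdeg, hmax, hhat⟩ := key hirr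
  have hrc : (specRadius T : ℂ) ≠ 0 := by exact_mod_cast hr.ne'
  have hL0 : L ≠ 0 := by rintro rfl; simp at hψL
  have hψcont : Continuous ψ := ψ.continuous_of_finiteDimensional
  have hpow := LinearMap.apply_pow_of_apply_eq hψT
  obtain ⟨q, B, hB, hspan⟩ :=
    exists_isChoiKraus_canonicalExtension hψ.nonneg hψ.faithful hL hhat
  have hzero : ∀ X : BlockAlgebra n, 0 ≤ X →
      Tendsto (fun k : ℕ => ((specRadius T : ℂ) ^ k)⁻¹ • (T ^ k) X) atTop (𝓝 0) → X = 0 := by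
    intro X hX hlim
    refine hψ.faithful X hX ?_
    -- `ψ` is constant along the normalized orbit of `X`
    have h1 := (hψcont.tendsto 0).comp hlim
    have h2 : (ψ ∘ fun k : ℕ => ((specRadius T : ℂ) ^ k)⁻¹ • (T ^ k) X) = fun _ => ψ X := by
      ext k
      simp only [Function.comp_apply, map_smul, hpow, smul_eq_mul]
      rw [inv_mul_cancel_left₀ (pow_ne_zero _ hrc)]
    rw [h2, map_zero] at h1
    exact tendsto_nhds_unique tendsto_const_nhds h1
  refine ⟨τhat, hmax, hdeg, ⟨hstrict hψ hL hhat, ?_⟩, ⟨?_, q, B, hspan, fun X => ?_⟩,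
    ⟨ψ, L, hψ, hL, hhat, hTL, hψL, hψT⟩, fun c hc X hX hXc => ?_, hzero, fun hr1 X hX hlim => ?_⟩
  · have : LinearMap.range τhat = Submodule.span ℂ {L} := by
      refine le_antisymm ?_ ?_
      · rintro _ ⟨X, rfl⟩
        rw [hhat]
        exact Submodule.smul_mem _ _ (Submodule.mem_span_singleton_self L)
      · rw [Submodule.span_singleton_le_iff_mem]
        exact ⟨L, by rw [hhat, hψL, one_smul]⟩
    rw [this, finrank_span_singleton hL0]
  · rw [choiRank_eq_of_span_eq_top hB hspan]
    simp
  · rw [← hB]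
    change _ = Matrix.blockDiagonal' (τhat (Matrix.blockDiag' (Matrix.blockDiagonal' X)))
    rw [Matrix.blockDiag'_blockDiagonal']
  · refine hψ.faithful X hX (LinearMap.apply_eq_zero_of_mem_maxGenEigenspace hψT ?_ hXc)
    rintro rfl
    rw [Complex.norm_real, Real.norm_of_nonneg hr.le] at hc
    exact lt_irrefl _ hc
  · refine hzero X hX (squeeze_zero_norm (fun k => ?_) (tendsto_zero_iff_norm_tendsto_zero.1 hlim))
    rw [norm_smul, norm_inv, norm_pow, Complex.norm_real, Real.norm_of_nonneg hr.le]
    exact mul_le_of_le_one_left (norm_nonneg _) (inv_le_one_of_one_le₀ (one_le_pow₀ hr1))
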